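/- **Setting.** A ranked alphabet is a finite set $\Sigma$ of symbols, each $\sigma\in\Sigma$ with a rank $\mathrm{rk}(\sigma)\in\mathbb N$; $T_\Sigma(Q)$ is the set of finite $\Sigma$-trees whose leaves may also be labeled by elements of $Q$, and $T_\Sigma=T_\Sigma(\emptyset)$. Positions of a tree are words over $\mathbb N$; $t|_w$ is the subtree of $t$ at position $w$, $t(w)$ is its label at $w$, $t[t']_w$ is the replacement of that subtree by $t'$, and the height $\mathrm{ht}(t)$ is the maximal length of a position. We order positions by the lexicographic order $\preceq$ in which prefixes are larger. A *WTGh* over $\Sigma$ is a tuple $G=(Q\cup\{\bot\},\Sigma,F,P,\mathrm{wt})$ with a finite set $Q$ of states, a sink state $\bot\notin Q$, final weights $F\colon Q\cup\{\bot\}\to\mathbb N$, a finite set $P$ of productions $\ell\xrightarrow{E}q$, where $\ell\in T_\Sigma(Q\cup\{\bot\})\setminus(Q\cup\{\bot\})$, $q\in Q\cup\{\bot\}$, and $E$ is a finite set of pairs of positions (equality constraints), and weights $\mathrm{wt}\colon P\to\mathbb N$, such that * $F(\bot)=0$, and for every $\gamma\in\Sigma$ the sink production $p_\gamma=(\gamma(\bot,\dots,\bot)\xrightarrow{\emptyset}\bot)$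 belongs to $P$ and has weight $1$; * for every production $\ell\xrightarrow{E}q$ in $P$, the relation $E$ is an equivalence relation on a set of positions at which $\ell$ is labeled by elements of $Q\cup\{\bot\}$; and whenever $w$ is the $\preceq$-least element of its $E$-class and $v\ne w$ belongs to this class, $\ell(v)=\bot$ and $\ell(w)\neq\bot$. For $t\in T_\Sigma$, a derivation step $\xi\Rightarrow\zeta$ between trees in $T_\Sigma(Q\cup\{\bot\})$ with a production $p=(\ell\xrightarrow{E}q)$ at a position $w$ requires $\xi|_w=\ell$, $\zeta=\xi[q]_w$, and, for all $(v,v')\in E$, that $v,v'$ are positions of $t|_w$ with $(t|_w)|_v=(t|_w)|_{v'}$. Let $D_G^q(t)$ be the set of sequences $(p_1,w_1)\cdots(p_m,w_m)$ of steps that lead from $t$ to the state $q$ and satisfy $w_1\prec\dots\prec w_m$. Call $G$ *trim* if every production in $P$ other than the sink productions $p_\gamma$ occurs in some $d=(p_1,w_1)\cdots(p_m,w_m)\in D_G^{q}(t)$, for some $t\in T_\Sigma$ and some state $q$, with $F(q)\cdot\prod_{i}\mathrm{wt}(p_i)\neq 0$. Let $\mathrm{ht}(G)=|Q|\cdot\max_{(\ell\xrightarrow{E}q)\in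 P}\mathrm{ht}(\ell)$, where the maximum is $0$ if $P=\emptyset$. A trim WTGh $G$ has the *large duplication property* if there exist a production $\ell\xrightarrow{E}q$ in $P$, a constraint $(u,v)\in E$ with $\ell(u)\neq\bot=\ell(v)$, and a tree $t\in T_\Sigma$ such that $\mathrm{ht}(t)>\mathrm{ht}(G)$ and $D_G^{\ell(u)}(t)\neq\emptyset$. **Lemma.** Let $\Sigma$ be a fixed ranked alphabet. The following problem is decidable in polynomial time: given a trim WTGh $G$ over $\Sigma$, does $G$ have the large duplication property? That is, there are a (multi-stack) Turing machine $M$ and a polynomial $f$, depending only on $\Sigma$, such that for every trim WTGh $G$ and every word $c$ that describes $G$ over a finite alphabet (final weights, followed by the productions with their left-hand sides in prefix notation, targets, weights, and constraints, in any order of enumeration, with numbers in binary and the states in $Q$ numbered $0,\dots,|Q|-1$), $M$ on input $c$ halts after at most $f(|c|)$ steps and answers correctly whether $G$ has the large duplication property. -/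

import Mathlib

/-- A ranked alphabet: a finite set of symbols, each with a rank. -/
structure RankedAlphabet where
  Sym : Type
  [fin : Fintype Sym]
  rank : Sym → ℕ

/-- `RTree A Z` is the set `T_Σ(Z)` of `Σ`-trees indexed by `Z`. -/
inductive RTree (A : RankedAlphabet) (Z : Type) : Type
  | leaf (z : Z) : RTree A Z
  | node (s : A.Sym) (ts : Fin (A.rank s) → RTree A Z) : RTree A Z

/-- The set `T_Σ` of trees without indices. -/
abbrev GTree (A : RankedAlphabet) : Type := RTree A Empty

/-- Positions are words of natural numbers. The children of a node of rank `k` are numbered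
`0, …, k - 1`. -/
abbrev Pos : Type := List ℕ

/-- The strict lexicographic order `v ≺ w` on positions in which prefixes are larger. -/
def Pos.Before : Pos → Pos → Prop
  | [], _ => False
  | _ :: _, [] => True
  | i :: v, j :: w => i < j ∨ (i = j ∧ Pos.Before v w)

namespace RTree

variable {A : RankedAlphabet} {Z : Type}

/-- The subtree `t|_w`; it is `none` if `w` is not a position of `t`. -/
def subtreeAt : RTree A Z → Pos → Option (RTree A Z)
  | t, [] => some t
  | leaf _, _ :: _ => none
  | node s ts, i :: w => if h : i < A.rank s then subtreeAt (ts ⟨i, h⟩) w else none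

/-- The substitution `t[t']_w` of `t'` into `t` at `w`
(only used at positions `w` of `t`). -/
def replaceAt : RTree A Z → Pos → RTree A Z → RTree A Z
  | _, [], t' => t'
  | leaf z, _ :: _, _ => leaf z
  | node s ts, i :: w, t' =>
      node s (fun j => if j.val = i then replaceAt (ts j) w t' else ts j)

/-- The height: the maximal length of a position. -/
def height : RTree A Z → ℕ
  | leaf _ => 0
  | node _ ts => Finset.univ.sup (fun i => (ts i).height + 1)

/-- A tree without indices, seen as a tree indexed by `Z`. -/
def ofGround : GTree A → RTree A Z
  | leaf z => z.elim
  | node s ts => node s (fun i => ofGround (ts i))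

end RTree

/-- The tree `t` satisfies the equality constraint `(v, v')`: both are positions of `t`, and the
subtrees there coincide. -/
def GTree.Satisfies {A : RankedAlphabet} (t : GTree A) (c : Pos × Pos) : Prop :=
  ∃ s : GTree A, t.subtreeAt c.1 = some s ∧ t.subtreeAt c.2 = some s

/-- Productions `(ℓ, q, E)` with `ℓ ∈ T_Σ(Q) \ Q`, target state `q`, and a finite set `E` of
equality constraints. -/
structure Production (A : RankedAlphabet) (Q : Type) where
  lhs : RTree A Q
  lhs_not_state : ∀ q, lhs ≠ RTree.leaf q
  target : Q
  constr : Finset (Pos × Pos)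

/-- The height of a production is the height of its left-hand side. -/
def Production.height {A : RankedAlphabet} {Q : Type} (p : Production A Q) : ℕ := p.lhs.height

/-- Weighted tree grammars with equality constraints over `ℕ`, with set of states `Q`. -/
structure WTGc (A : RankedAlphabet) (Q : Type) where
  final : Q → ℕ
  prods : Finset (Production A Q)
  wt : {p // p ∈ prods} → ℕ

namespace WTGc

variable {A : RankedAlphabet} {Q : Type}

/-- A single derivation step `ξ ⇒ ζ` for the input tree `t`, which applies the production `p` at
the position `w`. -/
def Step (G : WTGc A Q) (t : GTree A) (p : {p // p ∈ G.prods}) (w : Pos) (ξ ζ : RTree A Q) :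
    Prop :=
  ξ.subtreeAt w = some p.1.lhs ∧ ζ = ξ.replaceAt w (RTree.leaf p.1.target) ∧
    ∃ s : GTree A, t.subtreeAt w = some s ∧ ∀ c ∈ p.1.constr, s.Satisfies c

/-- `G.Steps t d ξ ζ`: the sequence `d` of productions and positions leads from the sentential
form `ξ` to the sentential form `ζ`, for the input tree `t`. -/
inductive Steps (G : WTGc A Q) (t : GTree A) :
    List ({p // p ∈ G.prods} × Pos) → RTree A Q → RTree A Q → Prop
  | nil (ξ : RTree A Q) : Steps G t [] ξ ξ
  | cons {p : {p // p ∈ G.prods}} {w : Pos} {d : List ({p // p ∈ G.prods} × Pos)}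
      {ξ ζ η : RTree A Q} (h : G.Step t p w ξ ζ) (hd : Steps G t d ζ η) :
      Steps G t ((p, w) :: d) ξ η

/-- The set `D_G^q(t)` of complete left-most derivations for `t` to `q`. -/
def derivations (G : WTGc A Q) (q : Q) (t : GTree A) :
    Set (List ({p // p ∈ G.prods} × Pos)) :=
  {d | G.Steps t d (RTree.ofGround t) (RTree.leaf q) ∧
    (d.map Prod.snd).Pairwise Pos.Before}

/-- The weight of a derivation. -/
def weight (G : WTGc A Q) (d : List ({p // p ∈ G.prods} × Pos)) : ℕ :=
  (d.map (fun x => G.wt x.1)).prod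

/-- The production `p` occurs in some accepting derivation of nonzero weight. -/
def Useful (G : WTGc A Q) (p : {p // p ∈ G.prods}) : Prop :=
  ∃ (t : GTree A) (q : Q), ∃ d ∈ G.derivations q t,
    G.final q * G.weight d ≠ 0 ∧ p ∈ d.map Prod.fst

end WTGc

/-- The production `p_γ = (γ(⊥, …, ⊥) → ⊥)`, without constraints. States are elements of
`Q ∪ {⊥}` with `Q = {0, …, n - 1}` and with `⊥` represented by `none`. -/
def sinkProd (A : RankedAlphabet) (n : ℕ) (s : A.Sym) : Production A (Option (Fin n)) where
  lhs := RTree.node s (fun _ => RTree.leaf none)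
  lhs_not_state := by
    intro q h
    cases h
  target := none
  constr := ∅

/-- A WTGh `(Q ∪ {⊥}, Σ, F, P, wt)`, with states normalized to `Q = {0, …, n - 1}` and
`⊥ = none`. -/
structure WTGh (A : RankedAlphabet) where
  /-- the number `|Q|` of non-sink states -/
  n : ℕ
  toWTGc : WTGc A (Option (Fin n))
  final_sink : toWTGc.final none = 0
  sink_mem : ∀ s, sinkProd A n s ∈ toWTGc.prods
  sink_wt : ∀ s, toWTGc.wt ⟨sinkProd A n s, sink_mem s⟩ = 1
  /-- constraints only relate positions that are labeled by states (including `⊥`) -/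
  constr_pos : ∀ p ∈ toWTGc.prods, ∀ c ∈ p.constr,
    (∃ q, p.lhs.subtreeAt c.1 = some (RTree.leaf q)) ∧
    (∃ q, p.lhs.subtreeAt c.2 = some (RTree.leaf q))
  /-- the constraints form an equivalence relation on the set of constrained positions
  (reflexivity there follows) -/
  constr_symm : ∀ p ∈ toWTGc.prods, ∀ u v, (u, v) ∈ p.constr → (v, u) ∈ p.constr
  constr_trans : ∀ p ∈ toWTGc.prods, ∀ u v w,
    (u, v) ∈ p.constr → (v, w) ∈ p.constr → (u, w) ∈ p.constr
  /-- if `w` is the least element of its class and `v ≠ w` belongs to this class, then `v` is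
  labeled by `⊥` and `w` is not -/
  constr_sink : ∀ p ∈ toWTGc.prods, ∀ w v, (w, v) ∈ p.constr → v ≠ w →
    (∀ x, (w, x) ∈ p.constr → x = w ∨ Pos.Before w x) →
      p.lhs.subtreeAt v = some (RTree.leaf none) ∧
      p.lhs.subtreeAt w ≠ some (RTree.leaf none)

namespace WTGh

variable {A : RankedAlphabet}

/-- Trimness: every production, apart from the obligatory sink productions `p_γ`, is used in some
accepting derivation of nonzero weight. -/
def IsTrim (G : WTGh A) : Prop :=
  ∀ p : {p // p ∈ G.toWTGc.prods}, (∀ s, p.1 ≠ sinkProd A G.n s) → G.toWTGc.Useful p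

/-- `ht(G) = |Q| * ht(P)`, where `Q` does not contain the sink state. -/
def height (G : WTGh A) : ℕ := G.n * G.toWTGc.prods.sup Production.height

/-- The large duplication property. -/
def LargeDuplicationProperty (G : WTGh A) : Prop :=
  ∃ p ∈ G.toWTGc.prods, ∃ u v : Pos, (u, v) ∈ p.constr ∧
    ∃ q : Option (Fin G.n), p.lhs.subtreeAt u = some (RTree.leaf q) ∧ q ≠ none ∧
      p.lhs.subtreeAt v = some (RTree.leaf none) ∧
      ∃ t : GTree A, G.height < t.height ∧ (G.toWTGc.derivations q t).Nonempty

end WTGh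

/-- The finite alphabet over which grammars are written down. -/
inductive InputSymbol (A : RankedAlphabet) : Type
  | sym (s : A.Sym)
  | bit (b : Bool)
  | bot
  | item
  | close

namespace InputSymbol

variable {A : RankedAlphabet}

/-- Numbers are written in binary and ended by `close`. -/
def codeNat (k : ℕ) : List (InputSymbol A) :=
  (Computability.encodeNat k).map bit ++ [close]

/-- Each entry of a list is announced by `item`, and the list is ended by `close`. -/
def codeList {α : Type} (f : α → List (InputSymbol A)) (l : List α) : List (InputSymbol A) :=
  l.flatMap (fun x => item :: f x) ++ [close]

def codeState {n : ℕ} : Option (Fin n) → List (InputSymbol A)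
  | none => [bot]
  | some i => codeNat i.val

/-- Trees are written in prefix notation. -/
def codeTree {n : ℕ} : RTree A (Option (Fin n)) → List (InputSymbol A)
  | RTree.leaf q => codeState q
  | RTree.node s ts => sym s :: (List.ofFn (fun i => codeTree (ts i))).flatten

def codePos (w : Pos) : List (InputSymbol A) := codeList codeNat w

end InputSymbol

namespace WTGh

variable {A : RankedAlphabet}

open InputSymbol in
/-- `G.IsCode c`: the word `c` is a description of `G`, i.e. the list of all final weights followed
by a list of all productions, each with its left-hand side, its target state, its weight, and a
list of its constraints. The two kinds of finite sets may be enumerated in any order. -/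
def IsCode (G : WTGh A) (c : List (InputSymbol A)) : Prop :=
  ∃ (ps : List {p // p ∈ G.toWTGc.prods}) (es : {p // p ∈ G.toWTGc.prods} → List (Pos × Pos)),
    ps.Nodup ∧ (∀ p, p ∈ ps) ∧
    (∀ p, (es p).Nodup ∧ ∀ e, e ∈ es p ↔ e ∈ p.1.constr) ∧
    c = codeList (fun q => codeNat (G.toWTGc.final q)) (none :: (List.finRange G.n).map some) ++
      codeList (fun p => codeTree p.1.lhs ++ codeState p.1.target ++ codeNat (G.toWTGc.wt p) ++
        codeList (fun e => codePos e.1 ++ codePos e.2) (es p)) ps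

end WTGh

/-- The inputs of the decision problem: trim WTGh, each given by one of its descriptions. -/
structure TrimInput (A : RankedAlphabet) where
  G : WTGh A
  trim : G.IsTrim
  code : List (InputSymbol A)
  isCode : G.IsCode code

open Classical in
/-- The problem `R`, on instances written as words over `Γ`, is decidable in polynomial time: some
Turing machine answers it correctly on all instances, in a number of steps that is bounded by a
polynomial in the length of the input word. -/
def PolyTimeDecidable {I Γ : Type} (code : I → List Γ) (R : I → Prop) : Prop :=
  Nonempty (Turing.TM2ComputableInPolyTime code Computability.encodeBool
    (fun x => decide (R x)))

/-! Draw a graph on the states (`WTGh.Edge`). There is an edge from `x` to `y ≠ ⊥` if a production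
with target `x` has a leaf `y`, and a loop at `x` if such a production has a leaf `⊥` that no
constraint ties to another position. A free `⊥` accepts every tree, so it permits arbitrarily high
trees for `x`. A tied `⊥` contributes nothing new: its subtree equals the one at the least position
of its class, which is a proper leaf.

Heights of trees derivable to `x` thus correspond to lengths of walks from `x`. A high tree yields a
long walk (`WTGh.walk_of_high`). Conversely, trimness makes the productions applicable with all
constraints satisfied, so a long walk can be turned into a high tree by planting trees at leaves and
copying them along the constraints (`WTGh.exists_match_subtreeAt`, `WTGh.exists_high_of_walk`).
Proper states only lead to proper states, so by a pigeonhole argument (`Walk.of_card_le`) a walk of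
length |Q| from a proper state implies walks of every length. Hence, for any `k > ht(G)`, the
property holds iff some state whose trees get duplicated starts a walk of length `k`
(`WTGh.largeDuplicationProperty_iff`).

To decide this, list the edges together with edges from an extra source to all duplicated states,
and repeatedly delete every edge whose end starts no edge. After `k` rounds the survivors are the
edges whose end starts a walk of length `k` (`Cmd.mem_keepEdges_iterate`), so the answer is whether
a source edge survives.

The algorithm is written in a small language of stack programs whose only loop repeats its body as
often as the input is long. Polynomial running time is then automatic (`Cmd.code_reaches`). In
exchange, loops run too often, and correctness rests on bodies that do nothing once their work is
done (`Cmd.eval_rep_foldl`). -/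

/-! ### Stack programs and their machine code -/

/-- Programs over stacks indexed by `K` with entries in `Γ`. `loop c` runs `c` exactly as often as
the length of the input. -/
inductive Cmd (K Γ : Type) : Type
  | nop
  | push (k : K) (a : Γ)
  | pop (k : K)
  | seq (c d : Cmd K Γ)
  | case (k : K) (f : Option Γ → Cmd K Γ)
  | loop (c : Cmd K Γ)

namespace Cmd

variable {K Γ : Type}

infixr:60 " ;; " => Cmd.seq

/-- The effect of a program on the stacks, where loops run `N` times. -/
def eval [DecidableEq K] (N : ℕ) : Cmd K Γ → (K → List Γ) → (K → List Γ)
  | nop, S => S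
  | push k a, S => Function.update S k (a :: S k)
  | pop k, S => Function.update S k (S k).tail
  | seq c d, S => eval N d (eval N c S)
  | case k f, S => eval N (f (S k).head?) S
  | loop c, S => (eval N c)^[N] S

/-- The names of the stacks of the machine that runs a program. -/
inductive Stk (K : Type) : Type
  | user (k : K)
  | cnt
  | master
  | temp
  | inp
  | out
  deriving DecidableEq, Fintype

/-- The entries of the stacks. -/
abbrev Stk.Entry (α Γ : Type) : Stk K → Type
  | .user _ => Γ
  | .cnt => Bool
  | .master => Unit
  | .temp => Unit
  | .inp => α
  | .out => Bool

/-- The stacks of the machine, given one by one. -/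
def Stk.pack {α : Type} (S : K → List Γ) (z : List Bool) (m t : List Unit) (x : List α)
    (y : List Bool) : (k : Stk K) → List (Stk.Entry α Γ k)
  | .user k => S k
  | .cnt => z
  | .master => m
  | .temp => t
  | .inp => x
  | .out => y

section pack

variable {α : Type} (S : K → List Γ) (z : List Bool) (m t : List Unit) (x : List α)
  (y : List Bool)

@[simp] theorem Stk.pack_user (k : K) : Stk.pack S z m t x y (.user k) = S k := rfl
@[simp] theorem Stk.pack_cnt : Stk.pack S z m t x y .cnt = z := rfl
@[simp] theorem Stk.pack_master : Stk.pack S z m t x y .master = m := rfl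
@[simp] theorem Stk.pack_temp : Stk.pack S z m t x y .temp = t := rfl
@[simp] theorem Stk.pack_inp : Stk.pack S z m t x y .inp = x := rfl
@[simp] theorem Stk.pack_out : Stk.pack S z m t x y .out = y := rfl

variable [DecidableEq K]

@[simp] theorem Stk.update_pack_user (k : K) (l : List Γ) :
    Function.update (Stk.pack S z m t x y) (.user k) l
      = Stk.pack (Function.update S k l) z m t x y := by
  funext j
  rcases j with j | _ | _ | _ | _ | _ <;> try rfl
  by_cases h : j = k
  · subst h
    exact (Function.update_self ..).trans (Function.update_self (f := S) ..).symm
  · exact (Function.update_of_ne (by simpa using h) ..).trans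
      (Function.update_of_ne (f := S) h ..).symm

@[simp] theorem Stk.update_pack_cnt (l : List Bool) :
    Function.update (Stk.pack S z m t x y) .cnt l = Stk.pack S l m t x y := by
  funext j; rcases j with j | _ | _ | _ | _ | _ <;> rfl

@[simp] theorem Stk.update_pack_master (l : List Unit) :
    Function.update (Stk.pack S z m t x y) .master l = Stk.pack S z l t x y := by
  funext j; rcases j with j | _ | _ | _ | _ | _ <;> rfl

@[simp] theorem Stk.update_pack_temp (l : List Unit) :
    Function.update (Stk.pack S z m t x y) .temp l = Stk.pack S z m l x y := by
  funext j; rcases j with j | _ | _ | _ | _ | _ <;> rfl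

@[simp] theorem Stk.update_pack_inp (l : List α) :
    Function.update (Stk.pack S z m t x y) .inp l = Stk.pack S z m t l y := by
  funext j; rcases j with j | _ | _ | _ | _ | _ <;> rfl

@[simp] theorem Stk.update_pack_out (l : List Bool) :
    Function.update (Stk.pack S z m t x y) .out l = Stk.pack S z m t x l := by
  funext j; rcases j with j | _ | _ | _ | _ | _ <;> rfl

end pack

/-- The labels of the machine code of a program. -/
def Lab : Cmd K Γ → Type
  | nop => Empty
  | push _ _ => Unit
  | pop _ => Unit
  | seq c d => Lab c ⊕ Lab d
  | case _ f => Unit ⊕ (Σ o, Lab (f o))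
  | loop c => Fin 4 ⊕ Lab c

instance Lab.finite [Finite Γ] : (c : Cmd K Γ) → Finite (Lab c)
  | nop => inferInstanceAs (Finite Empty)
  | push _ _ => inferInstanceAs (Finite Unit)
  | pop _ => inferInstanceAs (Finite Unit)
  | seq c d =>
    have := Lab.finite c
    have := Lab.finite d
    inferInstanceAs (Finite (Lab c ⊕ Lab d))
  | case _ f =>
    have := fun o => Lab.finite (f o)
    inferInstanceAs (Finite (Unit ⊕ (Σ o, Lab (f o))))
  | loop c =>
    have := Lab.finite c
    inferInstanceAs (Finite (Fin 4 ⊕ Lab c))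

/-- The label at which the code of a program is entered, if its labels are embedded by `e` and the
execution continues at `next`. -/
def entry {L : Type} : (c : Cmd K Γ) → (Lab c → L) → L → L
  | nop, _, next => next
  | push _ _, e, _ => e ()
  | pop _, e, _ => e ()
  | seq c d, e, next => entry c (fun l => e (.inl l)) (entry d (fun l => e (.inr l)) next)
  | case _ _, e, _ => e (.inl ())
  | loop _, e, _ => e (.inl 0)

/-- The statements of the machine. -/
abbrev MStmt (K Γ α L : Type) : Type :=
  Turing.TM2.Stmt (Stk.Entry (K := K) α Γ) L (Option Γ × Bool)

/-- The machine code of a program. -/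
def code (α : Type) {L : Type} : (c : Cmd K Γ) → (Lab c → L) → L → Lab c → MStmt K Γ α L
  | nop, _, _, l => Empty.elim l
  | push k a, _, next, _ => .push (.user k) (fun _ => a) (.goto fun _ => next)
  | pop k, _, next, _ => .pop (.user k) (fun v _ => v) (.goto fun _ => next)
  | seq c d, e, next, .inl l =>
      code α c (fun l => e (.inl l)) (entry d (fun l => e (.inr l)) next) l
  | seq _ d, e, next, .inr l => code α d (fun l => e (.inr l)) next l
  | case k f, e, next, .inl _ =>
      .peek (.user k) (fun v o => (o, v.2))
        (.goto fun v => entry (f v.1) (fun l => e (.inr ⟨v.1, l⟩)) next)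
  | case _ f, e, next, .inr ⟨o, l⟩ => code α (f o) (fun l => e (.inr ⟨o, l⟩)) next l
  -- Label 0 pushes the marker `false` on `cnt`, label 1 adds one `true` per unit of `master`, label
  -- 2 restores `master`, and label 3 spends one `true` per run of the body until it meets the
  -- marker. The markers let nested loops share one counter stack.
  | loop _, e, _, .inl 0 => .push .cnt (fun _ => false) (.goto fun _ => e (.inl 1))
  | loop _, e, _, .inl 1 =>
      .pop .master (fun v o => (v.1, o.isSome)) (.branch (fun v => v.2)
        (.push .temp (fun _ => ()) (.push .cnt (fun _ => true) (.goto fun _ => e (.inl 1))))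
        (.goto fun _ => e (.inl 2)))
  | loop _, e, _, .inl 2 =>
      .pop .temp (fun v o => (v.1, o.isSome)) (.branch (fun v => v.2)
        (.push .master (fun _ => ()) (.goto fun _ => e (.inl 2)))
        (.goto fun _ => e (.inl 3)))
  | loop c, e, next, .inl 3 =>
      .pop .cnt (fun v (o : Option Bool) => (v.1, o = some true)) (.branch (fun v => v.2)
        (.goto fun _ => entry c (fun l => e (.inr l)) (e (.inl 3)))
        (.goto fun _ => next))
  | loop c, e, _, .inr l => code α c (fun l => e (.inr l)) (e (.inl 3)) l

/-- A bound for the number of steps, as a polynomial in the length of the input. -/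
noncomputable def cost [Fintype Γ] : Cmd K Γ → Polynomial ℕ
  | nop => 0
  | push _ _ => 1
  | pop _ => 1
  | seq c d => cost c + cost d
  | case _ f => 1 + ∑ o, cost (f o)
  -- For `N` repetitions: one step for the marker, `N + 1` each for filling and restoring, and `N +
  -- 1` tests besides the runs of the body.
  | loop c => Polynomial.X * (cost c + 3) + 4

end Cmd

/-! ### Reachability with a bound on the number of steps -/

/-- `b` is reached from `a` in at most `T` steps. -/
def ReachesIn {C : Type} (step : C → Option C) (a : C) (b : C) (T : ℕ) : Prop :=
  ∃ t ≤ T, (flip bind step)^[t] (some a) = some b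

namespace ReachesIn

variable {C : Type} {step : C → Option C} {a b c : C} {T T' : ℕ}

theorem refl (a : C) : ReachesIn step a a 0 := ⟨0, le_rfl, rfl⟩

theorem trans (h : ReachesIn step a b T) (h' : ReachesIn step b c T') :
    ReachesIn step a c (T + T') := by
  obtain ⟨t, ht, e⟩ := h
  obtain ⟨t', ht', e'⟩ := h'
  refine ⟨t' + t, by omega, ?_⟩
  rw [Function.iterate_add_apply, e, e']

theorem mono (h : ReachesIn step a b T) (hT : T ≤ T') : ReachesIn step a b T' := by
  obtain ⟨t, ht, e⟩ := h
  exact ⟨t, ht.trans hT, e⟩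

theorem single (h : step a = some b) : ReachesIn step a b 1 := ⟨1, le_rfl, h⟩

theorem head (h : step a = some b) (h' : ReachesIn step b c T) : ReachesIn step a c (T + 1) :=
  ((single h).trans h').mono (by omega)

end ReachesIn

/-! ### Correctness and running time of the machine code -/

namespace Cmd

variable {K Γ : Type} [DecidableEq K] {α L : Type}

/-- Configurations of the machine while it runs a program. -/
def cfg (l : L) (v : Option Γ × Bool) (S : K → List Γ) (z : List Bool) (m t : ℕ)
    (x : List α := []) (y : List Bool := []) :
    Turing.TM2.Cfg (Stk.Entry (K := K) α Γ) L (Option Γ × Bool) :=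
  ⟨some l, v, Stk.pack S z (List.replicate m ()) (List.replicate t ()) x y⟩

/-- Each unit of `master` costs one step and leaves one `true`; the additional step notices that
`master` is empty. -/
theorem code_fill (M : L → MStmt K Γ α L) (c : Cmd K Γ) (e : Lab (loop c) → L) (next : L)
    (hM : ∀ l, M (e l) = code α (loop c) e next l) (S : K → List Γ) (m : ℕ) :
    ∀ (v : Option Γ × Bool) (z : List Bool) (t : ℕ), ∃ v',
      ReachesIn (Turing.TM2.step M) (cfg (e (.inl 1)) v S z m t)
        (cfg (e (.inl 2)) v' S (List.replicate m true ++ z) 0 (m + t)) (m + 1) := by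
  induction m with
  | zero =>
    intro v z t
    refine ⟨(v.1, false), ReachesIn.single ?_⟩
    have := hM (.inl 1)
    simp [cfg, this, code]
  | succ m ih =>
    intro v z t
    obtain ⟨v', h⟩ := ih (v.1, true) (true :: z) (t + 1)
    refine ⟨v', ReachesIn.head (b := cfg (e (.inl 1)) (v.1, true) S (true :: z) m (t + 1)) ?_ ?_⟩
    · have := hM (.inl 1)
      simp [cfg, this, code, List.replicate_succ]
    · have e1 : List.replicate (m + 1) true ++ z = List.replicate m true ++ true :: z := by
        rw [List.replicate_succ', List.append_assoc]; rfl
      rw [e1, show m + 1 + t = m + (t + 1) by omega]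
      exact h

/-- Makes the input length available again for inner and later loops. -/
theorem code_restore (M : L → MStmt K Γ α L) (c : Cmd K Γ) (e : Lab (loop c) → L) (next : L)
    (hM : ∀ l, M (e l) = code α (loop c) e next l) (S : K → List Γ) (z : List Bool) (t : ℕ) :
    ∀ (v : Option Γ × Bool) (m : ℕ), ∃ v',
      ReachesIn (Turing.TM2.step M) (cfg (e (.inl 2)) v S z m t)
        (cfg (e (.inl 3)) v' S z (t + m) 0) (t + 1) := by
  induction t with
  | zero =>
    intro v m
    refine ⟨(v.1, false), ReachesIn.single ?_⟩
    have := hM (.inl 2)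
    simp [cfg, this, code]
  | succ t ih =>
    intro v m
    obtain ⟨v', h⟩ := ih (v.1, true) (m + 1)
    refine ⟨v', ReachesIn.head (b := cfg (e (.inl 2)) (v.1, true) S z (m + 1) t) ?_ ?_⟩
    · have := hM (.inl 2)
      simp [cfg, this, code, List.replicate_succ]
    · rw [show t + 1 + m = t + (m + 1) by omega]
      exact h

/-- Structural induction. Since the code is embedded in a larger machine, `e` and `next` are
arbitrary; since an inner loop works above the pending counters of the outer ones, so is the content
`z` of `cnt`. The invariant is that `master` holds `N` units and `temp` is empty. -/
theorem code_reaches [Fintype Γ] (M : L → MStmt K Γ α L) (N : ℕ) (c : Cmd K Γ) :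
    ∀ (e : Lab c → L) (next : L), (∀ l, M (e l) = code α c e next l) →
      ∀ (v : Option Γ × Bool) (S : K → List Γ) (z : List Bool), ∃ v',
        ReachesIn (Turing.TM2.step M) (cfg (entry c e next) v S z N 0)
          (cfg next v' (eval N c S) z N 0) ((cost c).eval N) := by
  induction c with
  | nop => intro e next hM v S z; exact ⟨v, (ReachesIn.refl _).mono (by simp)⟩
  | push k a =>
    intro e next hM v S z
    refine ⟨v, (ReachesIn.single ?_).mono (by simp [cost])⟩
    have := hM ()
    simp [cfg, entry, this, code, eval]
  | pop k =>
    intro e next hM v S z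
    refine ⟨v, (ReachesIn.single ?_).mono (by simp [cost])⟩
    have := hM ()
    simp [cfg, entry, this, code, eval]
  | seq c d ihc ihd =>
    intro e next hM v S z
    obtain ⟨v1, h1⟩ := ihc (fun l => e (.inl l)) (entry d (fun l => e (.inr l)) next)
      (fun l => hM (.inl l)) v S z
    obtain ⟨v2, h2⟩ := ihd (fun l => e (.inr l)) next (fun l => hM (.inr l)) v1 (eval N c S) z
    refine ⟨v2, ?_⟩
    have := h1.trans h2
    simpa [cost, entry, eval] using this
  | case k f ih =>
    intro e next hM v S z
    obtain ⟨v1, h1⟩ := ih (S k).head? (fun l => e (.inr ⟨_, l⟩)) next (fun l => hM (.inr ⟨_, l⟩))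
      ((S k).head?, v.2) S z
    refine ⟨v1, (ReachesIn.head ?_ h1).mono ?_⟩
    · have := hM (.inl ())
      simp [cfg, entry, this, code]
    · simp only [cost, Polynomial.eval_add, Polynomial.eval_one, Polynomial.eval_finsetSum]
      have := Finset.single_le_sum (f := fun o => (cost (f o)).eval N) (fun _ _ => Nat.zero_le _)
        (Finset.mem_univ (S k).head?)
      omega
  | loop c ih =>
    intro e next hM v S z
    -- `n` entries `true` above the marker mean that `n` runs of the body remain.
    have test : ∀ (n : ℕ) (v : Option Γ × Bool) (S : K → List Γ), ∃ v',
        ReachesIn (Turing.TM2.step M)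
          (cfg (e (.inl 3)) v S (List.replicate n true ++ false :: z) N 0)
          (cfg next v' ((eval N c)^[n] S) z N 0) (n * ((cost c).eval N + 1) + 1) := by
      intro n
      induction n with
      | zero =>
        intro v S
        refine ⟨(v.1, false), (ReachesIn.single ?_).mono (by simp)⟩
        have := hM (.inl 3)
        simp [cfg, this, code]
      | succ n ihn =>
        intro v S
        obtain ⟨v1, h1⟩ := ih (fun l => e (.inr l)) (e (.inl 3)) (fun l => hM (.inr l)) (v.1, true) S
          (List.replicate n true ++ false :: z)
        obtain ⟨v2, h2⟩ := ihn v1 (eval N c S)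
        refine ⟨v2, (ReachesIn.head ?_ (h1.trans h2)).mono ?_⟩
        · have := hM (.inl 3)
          simp [cfg, this, code, List.replicate_succ]
        · linarith [Nat.succ_mul n ((cost c).eval N + 1)]
    obtain ⟨v1, h1⟩ := code_fill M c e next hM S N v (false :: z) 0
    obtain ⟨v2, h2⟩ := code_restore M c e next hM S (List.replicate N true ++ false :: z) N v1 0
    obtain ⟨v3, h3⟩ := test N v2 S
    refine ⟨v3, (ReachesIn.head ?_ ((h1.trans h2).trans h3)).mono ?_⟩
    · have := hM (.inl 0)
      simp [cfg, entry, this, code]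
    · simp [cost]
      linarith [Nat.mul_add N ((cost c).eval N) 3, Nat.mul_add N ((cost c).eval N) 1]

/-! ### The complete machine, and a criterion for decidability in polynomial time -/

/-- The machine that reads the input into the stack `i`, runs a program, and answers according to
whether the stack `o` is nonempty. -/
def machine (c : Cmd K Γ) (i o : K) (g : α → Γ) (d : Γ) : Lab c ⊕ Fin 3 →
    MStmt K Γ α (Lab c ⊕ Fin 3)
  | .inl l => code α c .inl (.inr 1) l
  | .inr 0 =>
      .pop .inp (fun _ o => (Option.map g o, o.isSome)) (.branch (fun v => v.2)
        (.push (.user i) (fun v => v.1.getD d) (.push .master (fun _ => ())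
          (.goto fun _ => .inr 0)))
        (.goto fun _ => entry c .inl (.inr 1)))
  | .inr 1 =>
      .pop (.user o) (fun _ o => (none, o.isSome)) (.push .out (fun v => v.2) (.goto fun _ => .inr 2))
  | .inr 2 =>
      .pop .master (fun _ o => (none, o.isSome)) (.branch (fun v => v.2)
        (.goto fun _ => .inr 2) (.load (fun _ => (none, false)) .halt))

/-- Entries are pushed in the order in which they are popped, so the input arrives reversed. Each
also leaves a unit on `master`, which ends up holding the input length. -/
theorem machine_read (c : Cmd K Γ) (i o : K) (g : α → Γ) (d : Γ) (x : List α) :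
    ∀ (v : Option Γ × Bool) (S : K → List Γ) (n : ℕ), ∃ v',
      ReachesIn (Turing.TM2.step (machine c i o g d)) (cfg (.inr 0) v S [] n 0 x)
        (cfg (entry c .inl (.inr 1)) v' (Function.update S i ((x.map g).reverse ++ S i)) []
          (x.length + n) 0) (x.length + 1) := by
  induction x with
  | nil =>
    intro v S n
    refine ⟨(none, false), ReachesIn.single ?_⟩
    simp [cfg, machine]
  | cons a x ih =>
    intro v S n
    obtain ⟨v', h⟩ := ih (some (g a), true) (Function.update S i (g a :: S i)) (n + 1)
    refine ⟨v', ReachesIn.head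
      (b := cfg (.inr 0) (some (g a), true) (Function.update S i (g a :: S i)) [] (n + 1) 0 x) ?_ ?_⟩
    · simp [cfg, machine, List.replicate_succ]
    · simpa [add_assoc, add_comm 1 n] using h

/-- The halting configuration requires all stacks but the output to be empty, so `master` has to be
drained. -/
theorem machine_clean (c : Cmd K Γ) (i o : K) (g : α → Γ) (d : Γ) (S : K → List Γ)
    (y : List Bool) (n : ℕ) : ∀ (v : Option Γ × Bool),
      ReachesIn (Turing.TM2.step (machine c i o g d)) (cfg (.inr 2) v S [] n 0 [] y)
        ⟨none, (none, false), Stk.pack S [] [] [] [] y⟩ (n + 1) := by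
  induction n with
  | zero =>
    intro v
    refine ReachesIn.single ?_
    simp [cfg, machine]
  | succ n ih =>
    intro v
    refine ReachesIn.head (b := cfg (.inr 2) (none, true) S [] n 0 [] y) ?_ (ih _)
    simp [cfg, machine, List.replicate_succ]

end Cmd

/-- A problem is decidable in polynomial time if a program answers it on all instances, by leaving
the stack `o` nonempty or empty. -/
theorem polyTimeDecidable_of_cmd {I α K Γ : Type} [DecidableEq K] [Finite K] [Finite Γ] [Finite α]
    (code : I → List α) (R : I → Prop) (c : Cmd K Γ) (i o : K) (g : α → Γ) (d : Γ)
    (h : ∀ x, ∃ y : List Γ, (y ≠ [] ↔ R x) ∧ y.length ≤ 1 ∧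
      c.eval (code x).length (Function.update (fun _ => []) i ((code x).map g).reverse)
        = Function.update (fun _ => []) o y) :
    PolyTimeDecidable code R := by
  classical
  have : Fintype K := Fintype.ofFinite K
  have : Fintype Γ := Fintype.ofFinite Γ
  have : Fintype (Cmd.Lab c) := Fintype.ofFinite _
  let tm : Turing.FinTM2 :=
    { K := Cmd.Stk K
      k₀ := .inp
      k₁ := .out
      Γ := Cmd.Stk.Entry α Γ
      Λ := Cmd.Lab c ⊕ Fin 3
      main := .inr 0
      σ := Option Γ × Bool
      initialState := (none, false)
      Γk₀Fin := Fintype.ofFinite α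
      m := Cmd.machine c i o g d }
  -- Reading and cleaning take `N + 1` steps each and answering takes one, which gives `X + X + 3`
  -- besides the cost of the program.
  refine ⟨{ tm := tm, inputAlphabet := Equiv.refl α, outputAlphabet := Equiv.refl Bool,
            time := Polynomial.X + Polynomial.X + c.cost + 3, outputsFun := fun x => ?_ }⟩
  have hx : Nonempty (Turing.TM2OutputsInTime tm ((code x))
      (some (Computability.encodeBool (decide (R x))))
      ((Polynomial.X + Polynomial.X + c.cost + 3).eval (code x).length)) := by
    obtain ⟨y, hy, hlen, hev⟩ := h x
    set n := (code x).length with hn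
    obtain ⟨v1, h1⟩ := Cmd.machine_read c i o g d (code x) (none, false) (fun _ => []) 0
    obtain ⟨v2, h2⟩ := Cmd.code_reaches (Cmd.machine c i o g d) n c .inl (.inr 1) (fun _ => rfl) v1
      (Function.update (fun _ => []) i ((code x).map g).reverse) []
    rw [hev] at h2
    have hb : y.head?.isSome = decide (R x) := by
      rcases y with _ | ⟨a, y⟩ <;> simp at hy ⊢ <;> simpa using hy
    -- The pop that determines the answer must also leave the stack `o` empty.
    have hty : y.tail = [] := by
      rcases y with _ | ⟨a, _ | ⟨b, y⟩⟩ <;> simp at hlen ⊢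
    have h3 : ReachesIn (Turing.TM2.step (Cmd.machine c i o g d))
        (Cmd.cfg (.inr 1) v2 (Function.update (fun _ => []) o y) [] n 0)
        (Cmd.cfg (.inr 2) (none, decide (R x)) (fun _ => []) [] n 0 [] [decide (R x)]) 1 := by
      refine ReachesIn.single ?_
      simp [Cmd.cfg, Cmd.machine, hb, hty]
    have h4 := Cmd.machine_clean c i o g d (fun _ => []) [decide (R x)] n (none, decide (R x))
    simp only [List.append_nil, add_zero] at h1
    obtain ⟨t, ht, e⟩ := ((h1.trans h2).trans h3).trans h4
    refine ⟨⟨⟨t, ?_⟩, ?_⟩⟩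
    · change (flip bind (Turing.TM2.step (Cmd.machine c i o g d)))^[t]
        (some (Turing.initList tm (code x))) =
          some (Turing.haltList tm (Computability.encodeBool (decide (R x))))
      have e1 : Turing.initList tm (code x) =
          Cmd.cfg (K := K) (Γ := Γ) (.inr 0) (none, false) (fun _ => []) [] 0 0 (code x) := by
        simp only [Turing.initList, Cmd.cfg, tm]
        congr 1
        funext k
        rcases k with k | _ | _ | _ | _ | _ <;> rfl
      have e2 : Turing.haltList tm (Computability.encodeBool (decide (R x))) =
          ⟨none, (none, false), Cmd.Stk.pack (fun _ => []) [] [] [] [] [decide (R x)]⟩ := by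
        simp only [Turing.haltList, tm]
        congr 1
        funext k
        rcases k with k | _ | _ | _ | _ | _ <;> rfl
      rw [e1, e2]
      exact e
    · refine ht.trans ?_
      simp
      omega
  have e (l : List α) : l.map (Equiv.refl α).invFun = l := List.map_id l
  have e' (l : List Bool) : l.map (Equiv.refl Bool).invFun = l := List.map_id l
  rw [e, e']
  exact Classical.choice hx

/-! ### Stacks and stack entries of the decision procedure -/

/-- The stacks used by the decision procedure. -/
inductive Reg : Type
  /-- the reversed input -/
  | W
  /-- the remaining input -/
  | I
  /-- the current position in the tree that is read -/
  | P
  /-- leaves, or edges that are processed -/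
  | L
  /-- the target state -/
  | T
  /-- constraints that have been read -/
  | D
  /-- the list that is searched, and the part of it that has been processed -/
  | C
  | C2
  /-- the string that is searched for, and the part of it that has been compared -/
  | X
  | X2
  | Y
  /-- the result of a search -/
  | G
  /-- edges -/
  | E
  /-- auxiliary -/
  | R
  deriving DecidableEq

instance Reg.finite : Finite Reg :=
  Fintype.finite ⟨[Reg.W, .I, .P, .L, .T, .D, .C, .C2, .X, .X2, .Y, .G, .E, .R].toFinset,
    fun r => by cases r <;> simp⟩

/-- The entries of the stacks. -/
inductive Tok (A : RankedAlphabet) : Type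
  | inp (a : InputSymbol A)
  | dir (s : A.Sym) (i : Fin (A.rank s))
  | root
  | sep
  | src

/-! ### Iteration up to a fixed point; moving, clearing and copying -/

namespace Cmd

variable {Γ : Type} {N : ℕ}

/-- The number of iterations of `rep`. -/
def bound (N : ℕ) : ℕ := N * N * N * N

/-- Runs a program `bound N` times. -/
def rep {K : Type} (c : Cmd K Γ) : Cmd K Γ := loop (loop (loop (loop c)))

theorem eval_rep {K : Type} [DecidableEq K] (c : Cmd K Γ) (S : K → List Γ) :
    eval N (rep c) S = (eval N c)^[bound N] S := by
  simp only [rep, eval, ← Function.iterate_mul, bound]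

/-- A loop that reaches a fixed point of its body in time ends there. -/
theorem eval_rep_of_iterate {K : Type} [DecidableEq K] {c : Cmd K Γ} {S S' : K → List Γ} {m : ℕ}
    (h : (eval N c)^[m] S = S') (h' : eval N c S' = S') (hm : m ≤ bound N) :
    eval N (rep c) S = S' := by
  rw [eval_rep, ← Nat.sub_add_cancel hm, Function.iterate_add_apply, h]
  exact Function.iterate_fixed h' _

/-- A loop that consumes a list. -/
theorem eval_rep_foldl {K α β : Type} [DecidableEq K] {c : Cmd K Γ}
    (st : β → List α → K → List Γ) (g : β → α → β) (l : List α) (b : β)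
    (hstep : ∀ b a l', a ∈ l → eval N c (st b (a :: l')) = st (g b a) l')
    (hfix : ∀ b, eval N c (st b []) = st b []) (hl : l.length ≤ bound N) :
    eval N (rep c) (st b l) = st (l.foldl g b) [] := by
  refine eval_rep_of_iterate (m := l.length) ?_ (hfix _) hl
  clear hl
  induction l generalizing b with
  | nil => rfl
  | cons a l ih =>
    rw [List.length_cons, Function.iterate_succ_apply, hstep _ _ _ (by simp), List.foldl_cons]
    exact ih _ fun b a' l' h => hstep b a' l' (List.mem_cons_of_mem _ h)

/-- Moves one entry `x` from `a` to `b`. -/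
def mv {K : Type} (a b : K) (x : Γ) : Cmd K Γ := pop a ;; push b x

/-- Moves all entries from `a` to `b`. -/
def move {K : Type} (a b : K) : Cmd K Γ :=
  rep (case a fun | some x => mv a b x | none => nop)

/-- Empties the stack `a`. -/
def clear {K : Type} (a : K) : Cmd K Γ := rep (pop a)

/-- Copies the contents of `a` to `b`, by means of `R`. -/
def copy (a b : Reg) : Cmd Reg Γ :=
  move a .R ;; rep (case .R fun | some x => pop .R ;; push a x ;; push b x | none => nop)

section basic

variable (S : Reg → List Γ)

theorem foldl_cons (l b : List Γ) : l.foldl (fun acc x => x :: acc) b = l.reverse ++ b := by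
  induction l generalizing b with
  | nil => rfl
  | cons a l ih => simp [ih]

theorem eval_move {a b : Reg} (hab : a ≠ b) (ha : (S a).length ≤ bound N) :
    eval N (move a b) S
      = Function.update (Function.update S a []) b ((S a).reverse ++ S b) := by
  have := eval_rep_foldl (N := N) (c := case a fun | some x => mv a b x | none => nop)
    (fun acc l => Function.update (Function.update S a l) b acc) (fun acc x => x :: acc) (S a) (S b)
    (by
      intro acc x l _
      funext j
      simp only [eval, mv, Function.update_apply, hab, hab.symm, if_true, if_false, List.head?_cons,
        List.tail_cons]
      split_ifs <;> simp_all)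
    (by
      intro acc
      simp [eval, hab]) ha
  rw [foldl_cons] at this
  simpa [move] using this

theorem eval_clear {a : Reg} (ha : (S a).length ≤ bound N) :
    eval N (clear a) S = Function.update S a [] := by
  have := eval_rep_foldl (N := N) (c := (pop a : Cmd Reg Γ))
    (fun (_ : Unit) l => Function.update S a l) (fun _ _ => ()) (S a) ()
    (by intro acc x l _; simp [eval]) (by intro acc; simp [eval]) ha
  simpa [clear] using this

/-- The string is reversed on its way into `R` and reversed back on its way out into both stacks.
Anything already in `R` would be swept along. -/
theorem eval_copy {a b : Reg} (hab : a ≠ b) (haR : a ≠ .R) (hbR : b ≠ .R) (hR : S .R = [])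
    (ha : (S a).length ≤ bound N) :
    eval N (copy a b) S = Function.update S b (S a ++ S b) := by
  have := eval_rep_foldl (N := N)
    (c := case .R fun | some x => pop .R ;; push a x ;; push b x | none => nop)
    (fun acc l => Function.update (Function.update (Function.update S a acc) .R l) b (acc ++ S b))
    (fun acc x => x :: acc) (S a).reverse []
    (by
      intro acc x l _
      funext j
      simp only [eval, Function.update_apply, hab, hab.symm, haR, haR.symm, hbR, hbR.symm, if_true,
        if_false, List.head?_cons, List.tail_cons]
      split_ifs <;> simp_all)
    (by
      intro acc
      simp [eval, hbR.symm]) (by simpa using ha)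
  simp only [copy, eval]
  rw [eval_move S haR ha]
  rw [foldl_cons] at this
  simp only [List.reverse_reverse, List.append_nil] at this
  convert this using 2
  · funext j
    simp only [Function.update_apply]
    split_ifs <;> simp_all
  · funext j
    simp only [Function.update_apply]
    split_ifs <;> simp_all

end basic


/-! ### Lists of pairs of strings, and searching in them -/

section segments

variable {A : RankedAlphabet} (S : Reg → List (Tok A))

/-- Moves entries from `a` to `b` until the next separator. -/
def toSep (a b : Reg) : Cmd Reg (Tok A) :=
  rep (case a fun | some .sep => nop | some x => mv a b x | none => nop)

/-- Moves the entries of `a` before the next separator to `b`, in the same order, and removes the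
separator. -/
def getSeg (a b : Reg) : Cmd Reg (Tok A) := toSep a .R ;; pop a ;; move .R b

/-- The code of a pair of strings. -/
def encPair (p : List (Tok A) × List (Tok A)) : List (Tok A) := p.1 ++ .sep :: (p.2 ++ [.sep])

/-- The code of a list of pairs of strings. -/
def encPairs (l : List (List (Tok A) × List (Tok A))) : List (Tok A) := l.flatMap encPair

/-- Strings without separators. -/
def SepFree (k : List (Tok A)) : Prop := ∀ x ∈ k, x ≠ .sep

theorem encPairs_cons (p : List (Tok A) × List (Tok A)) (l : List (List (Tok A) × List (Tok A))) :
    encPairs (p :: l) = p.1 ++ .sep :: (p.2 ++ .sep :: encPairs l) := by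
  simp [encPairs, encPair]

theorem length_le_encPairs (l : List (List (Tok A) × List (Tok A))) :
    l.length ≤ (encPairs l).length := by
  induction l with
  | nil => simp
  | cons p l ih => rw [encPairs_cons]; simp; omega

theorem eval_toSep {a b : Reg} (hab : a ≠ b) {k rest : List (Tok A)} (hk : SepFree k)
    (ha : S a = k ++ .sep :: rest) (hl : k.length ≤ bound N) :
    eval N (toSep a b) S
      = Function.update (Function.update S a (.sep :: rest)) b (k.reverse ++ S b) := by
  have := eval_rep_foldl (N := N)
    (c := case a fun | some Tok.sep => nop | some x => mv a b x | none => nop)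
    (fun acc l => Function.update (Function.update S a (l ++ .sep :: rest)) b acc)
    (fun acc x => x :: acc) k (S b)
    (by
      intro acc x l hx
      have hx := hk x hx
      funext j
      simp only [eval, mv, Function.update_apply, hab, if_false, if_true, List.cons_append,
        List.head?_cons]
      cases x <;> first
        | exact absurd rfl hx
        | (simp only [hab.symm, if_false]
           split_ifs <;> simp_all))
    (by
      intro acc
      simp [eval, hab]) hl
  rw [foldl_cons, ← ha] at this
  simpa [toSep] using this

theorem eval_getSeg {a b : Reg} (hab : a ≠ b) (haR : a ≠ .R) (hbR : b ≠ .R) (hR : S .R = [])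
    {k rest : List (Tok A)} (hk : SepFree k)
    (ha : S a = k ++ .sep :: rest) (hl : k.length ≤ bound N) :
    eval N (getSeg a b) S
      = Function.update (Function.update S a rest) b (k ++ S b) := by
  simp only [getSeg, eval]
  rw [eval_toSep S haR hk ha hl, eval_move _ hbR.symm (by simpa [haR.symm, hR] using hl)]
  funext j
  simp only [Function.update_apply, haR, hbR, haR.symm, hab.symm]
  split_ifs <;> simp_all

/-- Compares the string in `X` with the string at the top of `C`, as far as they agree. -/
noncomputable def cmp : Cmd Reg (Tok A) := by
  classical
  exact rep (case .C fun c => case .X fun x =>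
    match c with
    | none => nop
    | some c => if some c = x ∧ c ≠ .sep then mv .C .C2 c ;; mv .X .X2 c else nop)

/-- Isolates what `cmp` consumes: after `p`, either the next entries disagree or the string `k` is
used up, and then a separator is on top of `C`. -/
theorem exists_common_prefix {α : Type} (k x : List α) :
    ∃ p k' x', k = p ++ k' ∧ x = p ++ x' ∧ ∀ c ∈ k'.head?, x'.head? ≠ some c := by
  classical
  induction k generalizing x with
  | nil => exact ⟨[], [], x, rfl, rfl, by simp⟩
  | cons c k ih =>
    by_cases h : x.head? = some c
    · obtain ⟨y, rfl⟩ := List.head?_eq_some_iff.1 h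
      obtain ⟨p, k', x', rfl, rfl, h'⟩ := ih y
      exact ⟨c :: p, k', x', rfl, rfl, h'⟩
    · exact ⟨[], c :: k, x, rfl, rfl, by simpa using h⟩

theorem eval_cmp {p k' x' rest : List (Tok A)} (hp : SepFree p) (hC : S .C = p ++ (k' ++ .sep :: rest))
    (hX : S .X = p ++ x') (hl : p.length ≤ bound N) (hkx : ∀ c ∈ k'.head?, x'.head? ≠ some c) :
    eval N cmp S = Function.update (Function.update (Function.update (Function.update S
      .C (k' ++ .sep :: rest)) .X x') .C2 (p.reverse ++ S .C2)) .X2 (p.reverse ++ S .X2) := by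
  classical
  have := eval_rep_foldl (N := N)
    (c := case .C fun c => case .X fun x =>
      match c with
      | none => nop
      | some c => if some c = x ∧ c ≠ .sep then mv .C .C2 c ;; mv .X .X2 c else nop)
    (fun acc l => Function.update (Function.update (Function.update (Function.update S
      .C (l ++ (k' ++ .sep :: rest))) .X (l ++ x')) .C2 (acc ++ S .C2)) .X2 (acc ++ S .X2))
    (fun acc x => x :: acc) p []
    (by
      intro acc x l hx
      have hx := hp x hx
      funext j
      cases j <;> simp [eval, mv, hx])
    (by
      intro acc
      rcases k' with _ | ⟨c, k'⟩
      · simp [eval]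
      · simp only [List.head?_cons, Option.mem_def, Option.some.injEq, forall_eq'] at hkx
        have : ¬ (some c = x'.head? ∧ ¬ c = .sep) := fun h => hkx h.1.symm
        simp only [eval, ne_eq, Function.update_of_ne, Function.update_self, reduceCtorEq,
          not_false_eq_true, List.nil_append, List.cons_append, List.head?_cons, this, if_false]) hl
  rw [foldl_cons] at this
  have e : Function.update (Function.update (Function.update (Function.update S
      .C (p ++ (k' ++ .sep :: rest))) .X (p ++ x')) .C2 ([] ++ S .C2)) .X2 ([] ++ S .X2) = S := by
    funext j
    cases j <;> simp [hC, hX]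
  rw [e] at this
  simpa [cmp] using this

/-- A Boolean flag on a stack. -/
def flag (b : Bool) : List (Tok A) := if b then [.src] else []

@[simp] theorem flag_true : (flag true : List (Tok A)) = [.src] := rfl
@[simp] theorem flag_false : (flag false : List (Tok A)) = [] := rfl

/-- Processes one pair of the list in `C`. -/
noncomputable def searchBody : Cmd Reg (Tok A) :=
  case .C fun
    | none => nop
    | some _ =>
      cmp ;;
      (case .C fun
        | some .sep => case .X fun
          | none => case .G fun
            | none => push .G .src
            | some _ => nop
          | some _ => nop
        | _ => nop) ;;
      move .X2 .X ;; toSep .C .C2 ;; mv .C .C2 .sep ;; toSep .C .C2 ;; mv .C .C2 .sep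

/-- Searches for a pair in `C` whose first component is the string in `X`. -/
noncomputable def search : Cmd Reg (Tok A) := rep searchBody ;; move .C2 .C

/-- The strings are equal iff both remainders after their common prefix are empty. `X` is rebuilt
from `X2`, and a flag already raised is not raised twice. -/
theorem eval_searchBody {k v rest : List (Tok A)} (hk : SepFree k) (hv : SepFree v) {b : Bool}
    (hC : S .C = k ++ .sep :: (v ++ .sep :: rest)) (hX2 : S .X2 = []) (hG : S .G = flag b)
    (hkl : k.length ≤ bound N) (hvl : v.length ≤ bound N) [Decidable (k = S .X)] :
    eval N searchBody S = Function.update (Function.update (Function.update S .C rest)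
      .C2 ((encPair (k, v)).reverse ++ S .C2)) .G (flag (b || decide (k = S .X))) := by
  obtain ⟨p, k', x', hkp, hxp, hkx⟩ := exists_common_prefix k (S .X)
  have hne : (S .C).head? ≠ none := by rw [hC]; cases k <;> simp
  obtain ⟨c, hc⟩ := Option.ne_none_iff_exists'.1 hne
  have hp : SepFree p := fun x hx => hk x (by simp [hkp, hx])
  have hk' : SepFree k' := fun x hx => hk x (by simp [hkp, hx])
  have hpl : p.length ≤ bound N := by simp [hkp] at hkl; omega
  have hk'l : k'.length ≤ bound N := by simp [hkp] at hkl; omega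
  simp only [searchBody, eval, hc]
  rw [eval_cmp S hp (k' := k') (x' := x') (rest := v ++ .sep :: rest) (by simp [hC, hkp]) hxp hpl hkx]
  set S1 := Function.update (Function.update (Function.update (Function.update S
      .C (k' ++ .sep :: (v ++ .sep :: rest))) .X x') .C2 (p.reverse ++ S .C2)) .X2
      (p.reverse ++ S .X2) with hS1
  have h2 : eval N (match (S1 .C).head? with
      | some .sep => case .X fun
        | none => case .G fun
          | none => push .G .src
          | some _ => nop
        | some _ => nop
      | _ => (nop : Cmd Reg (Tok A))) S1 = Function.update S1 .G (flag (b || decide (k = S .X))) := by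
    have e1 : S1 .C = k' ++ .sep :: (v ++ .sep :: rest) := by simp [hS1]
    have e2 : S1 .X = x' := by simp [hS1]
    have e3 : S1 .G = flag b := by simp [hS1, hG]
    have noop (h : k ≠ S .X) : S1 = Function.update S1 .G (flag (b || decide (k = S .X))) := by
      rw [decide_eq_false h, Bool.or_false, ← e3, Function.update_eq_self]
    rw [e1]
    rcases k' with _ | ⟨c, k'⟩
    · rcases x' with _ | ⟨x, x'⟩
      · have : k = S .X := by rw [hkp, hxp]
        rw [decide_eq_true this]
        cases b
        · simp [eval, e2, e3]
        · simp [eval, e2, e3]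
      · have : k ≠ S .X := by rw [hkp, hxp]; simp
        simpa [eval, e2] using noop this
    · have hne : k ≠ S .X := by
        rw [hkp, hxp]
        intro h
        have h := List.append_cancel_left h
        exact hkx c rfl (by rw [← h]; rfl)
      have hcs : c ≠ .sep := hk' c (by simp)
      cases c <;> first | exact absurd rfl hcs | exact noop hne
  rw [h2, eval_move _ (by decide) (by simp [hS1, hX2, hpl])]
  set S2 := Function.update (Function.update (Function.update S1 .G
    (flag (b || decide (k = S .X)))) .X2 []) .X
    ((Function.update S1 .G (flag (b || decide (k = S .X))) .X2).reverse ++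
      Function.update S1 .G (flag (b || decide (k = S .X))) .X) with hS2
  rw [eval_toSep S2 (by decide) hk' (k := k') (rest := v ++ .sep :: rest)
    (by simp [hS2, hS1]) hk'l]
  simp only [mv, eval]
  rw [eval_toSep _ (by decide) hv (k := v) (rest := rest) (by simp) hvl]
  funext j
  cases j <;> simp [hS2, hS1, hX2, hxp, hkp, encPair]

/-- The pairs pass to `C2` reversed and the final move reverses them again, so only the flag changes
and `C` can be searched repeatedly. -/
theorem eval_search {l : List (List (Tok A) × List (Tok A))}
    (hl : ∀ p ∈ l, SepFree p.1 ∧ SepFree p.2) (hC : S .C = encPairs l) (hC2 : S .C2 = [])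
    (hX2 : S .X2 = []) (hG : S .G = []) (hb : (encPairs l).length ≤ bound N)
    [Decidable (∃ p ∈ l, p.1 = S .X)] :
    eval N search S = Function.update S .G (flag (decide (∃ p ∈ l, p.1 = S .X))) := by
  classical
  have len : ∀ p ∈ l, p.1.length ≤ bound N ∧ p.2.length ≤ bound N := by
    intro p hp
    have : (encPair p).length ≤ (encPairs l).length := by
      obtain ⟨s, t, rfl⟩ := List.append_of_mem hp
      simp [encPairs]; omega
    simp [encPair] at this
    omega
  have := eval_rep_foldl (N := N) (c := searchBody)
    (fun (acc : List (Tok A) × Bool) l => Function.update (Function.update (Function.update S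
      .C (encPairs l)) .C2 acc.1) .G (flag acc.2))
    (fun acc p => ((encPair p).reverse ++ acc.1, acc.2 || decide (p.1 = S .X))) l ([], false)
    (by
      intro acc p l' hp
      rw [eval_searchBody (k := p.1) (v := p.2) (rest := encPairs l') (b := acc.2) _ (hl p hp).1
        (hl p hp).2 (by simp [encPairs_cons]) (by simp [hX2]) (by simp) (len p hp).1 (len p hp).2]
      funext j
      cases j <;> simp)
    (by
      intro acc
      simp [eval, searchBody, encPairs]) ((length_le_encPairs l).trans hb)
  have e : Function.update (Function.update (Function.update S
      .C (encPairs l)) .C2 []) .G (flag false) = S := by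
    funext j
    cases j <;> simp [hC, hC2, hG]
  rw [e] at this
  have fold : ∀ (l : List (List (Tok A) × List (Tok A))) (acc : List (Tok A) × Bool),
      l.foldl (fun acc p => ((encPair p).reverse ++ acc.1, acc.2 || decide (p.1 = S .X))) acc
        = ((encPairs l).reverse ++ acc.1, acc.2 || decide (∃ p ∈ l, p.1 = S .X)) := by
    intro l
    induction l with
    | nil => intro acc; simp [encPairs]
    | cons p l ih =>
      intro acc
      rw [List.foldl_cons, ih]
      simp [encPairs, Bool.or_assoc]
  rw [fold] at this
  simp only [search, eval, this]
  rw [eval_move _ (by decide) (by simpa using hb)]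
  funext j
  cases j <;> simp [hC, hC2, encPairs]

end segments

end Cmd

/-! ### Loops over lists of pairs, and pruning of edges -/

namespace Cmd

variable {A : RankedAlphabet} {N : ℕ} (S : Reg → List (Tok A))

/-- Runs a program for all pairs in `L`, with the pair in `Y` and `X` and the result of the search
for `X` in `C` in `G`. -/
noncomputable def forPairs (body : Cmd Reg (Tok A)) : Cmd Reg (Tok A) :=
  rep (case .L fun
    | none => nop
    | some _ => getSeg .L .Y ;; getSeg .L .X ;; search ;; body ;; clear .X ;; clear .Y ;; clear .G)

/-- Pairs of strings without separators. -/
def PairsFree (l : List (List (Tok A) × List (Tok A))) : Prop := ∀ p ∈ l, SepFree p.1 ∧ SepFree p.2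

theorem length_of_mem_encPairs {l : List (List (Tok A) × List (Tok A))}
    {p : List (Tok A) × List (Tok A)} (hp : p ∈ l) :
    p.1.length + p.2.length + 2 ≤ (encPairs l).length := by
  obtain ⟨s, t, rfl⟩ := List.append_of_mem hp
  simp [encPairs, encPair]; omega

theorem encPairs_append (l l' : List (List (Tok A) × List (Tok A))) :
    encPairs (l ++ l') = encPairs l ++ encPairs l' := by
  simp [encPairs]

-- Results are put on top of `E`, so the contributions of `l` appear in reverse order. The body is
-- specified by `h` in terms of the two strings and the search flag alone; the same loop then serves
-- for pruning edges and for processing leaves.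
open Classical in
theorem eval_forPairs {body : Cmd Reg (Tok A)} {l c e : List (List (Tok A) × List (Tok A))}
    (h : List (Tok A) → List (Tok A) → Bool → List (List (Tok A) × List (Tok A)))
    (hl : PairsFree l) (hc : PairsFree c) (hL : S .L = encPairs l) (hC : S .C = encPairs c)
    (hE : S .E = encPairs e) (hX : S .X = []) (hY : S .Y = []) (hG : S .G = []) (hR : S .R = [])
    (hC2 : S .C2 = []) (hX2 : S .X2 = [])
    (hN : 0 < bound N) (hlb : l.length ≤ bound N)
    (hlb' : ∀ p ∈ l, p.1.length ≤ bound N ∧ p.2.length ≤ bound N)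
    (hcb : (encPairs c).length ≤ bound N)
    (hbody : ∀ (S' : Reg → List (Tok A)) (p) (b : Bool), p ∈ l → S' .Y = p.1 → S' .X = p.2 →
      S' .G = flag b → S' .R = [] → S' .T = S .T →
      eval N body S' = Function.update S' .E (encPairs (h p.1 p.2 b) ++ S' .E)) :
    eval N (forPairs body) S = Function.update (Function.update S .L []) .E
      (encPairs (l.reverse.flatMap (fun p => h p.1 p.2 (decide (∃ q ∈ c, q.1 = p.2))) ++ e)) := by
  have := eval_rep_foldl (N := N) (c := case .L fun
    | none => nop
    | some _ => getSeg .L .Y ;; getSeg .L .X ;; search ;; body ;; clear .X ;; clear .Y ;; clear .G)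
    (fun e l => Function.update (Function.update S .L (encPairs l)) .E (encPairs e))
    (fun e p => h p.1 p.2 (decide (∃ q ∈ c, q.1 = p.2)) ++ e) l e
    (by
      rintro e ⟨y, x⟩ l' hp
      obtain ⟨hyl, hxl⟩ := hlb' _ hp
      simp only at hyl hxl
      have hhead : (Function.update (Function.update S .L (encPairs ((y, x) :: l'))) .E (encPairs e)
          .L).head? ≠ none := by
        simp [encPairs_cons]
      obtain ⟨a, ha⟩ := Option.ne_none_iff_exists'.1 hhead
      simp only [eval, ha]
      rw [eval_getSeg (a := .L) (b := .Y) _ (by decide) (by decide) (by decide) (by simpa using hR) (hl _ hp).1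
        (k := y) (rest := x ++ .sep :: encPairs l') (by simp [encPairs_cons]) hyl,
        eval_getSeg (a := .L) (b := .X) _ (by decide) (by decide) (by decide) (by simpa using hR) (hl _ hp).2
        (k := x) (rest := encPairs l') (by simp) hxl,
        eval_search _ hc (by simpa using hC) (by simpa using hC2) (by simpa using hX2)
          (by simpa using hG) hcb,
        hbody _ (y, x) _ hp (by simp [hY]) (by simp [hX]) rfl (by simpa using hR) (by simp),
        eval_clear (a := .X) _ (by simpa [hX] using hxl), eval_clear (a := .Y) _ (by simpa [hY] using hyl),
        eval_clear _ (by
          simp only [ne_eq, Function.update_of_ne, Function.update_self, reduceCtorEq,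
            not_false_eq_true]
          unfold flag
          split_ifs <;> simp; omega)]
      funext j
      cases j <;> simp [hX, hY, hG, encPairs_append])
    (by
      intro e
      simp [eval, encPairs]) hlb
  have e1 : Function.update (Function.update S .L (encPairs l)) .E (encPairs e) = S := by
    funext j
    cases j <;> simp [hL, hE]
  rw [e1] at this
  rw [forPairs, this]
  have fold : ∀ (f : List (Tok A) × List (Tok A) → List (List (Tok A) × List (Tok A)))
      (l e : List (List (Tok A) × List (Tok A))),
      l.foldl (fun e p => f p ++ e) e = l.reverse.flatMap f ++ e := by
    intro f l
    induction l with
    | nil => intro e; simp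
    | cons p l ih => intro e; rw [List.foldl_cons, ih]; simp
  rw [fold (fun p => h p.1 p.2 (decide (∃ q ∈ c, q.1 = p.2)))]
  simp [encPairs]

/-- Adds the pair of the strings in `a` and `b` to `E`. -/
def emit (a b : Reg) : Cmd Reg (Tok A) :=
  push .E .sep ;; copy b .E ;; push .E .sep ;; copy a .E

/-- The parts are pushed back to front, because pairs are read from the top. -/
theorem eval_emit {a b : Reg} (ha : a ≠ .E) (hb : b ≠ .E) (haR : a ≠ .R) (hbR : b ≠ .R)
    (hR : S .R = []) (hal : (S a).length ≤ bound N) (hbl : (S b).length ≤ bound N) :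
    eval N (emit a b) S = Function.update S .E (encPairs [(S a, S b)] ++ S .E) := by
  simp only [emit, eval]
  rw [eval_copy (a := b) _ hb hbR (by decide) (by simpa using hR) (by simpa [hb] using hbl),
    eval_copy (a := a) _ ha haR (by decide) (by simpa using hR) (by simpa [ha] using hal)]
  simp [ha, hb, encPairs, encPair]

open Classical in
/-- Keeps the edges whose end is the start of an edge. -/
noncomputable def keepEdges (l : List (List (Tok A) × List (Tok A))) :
    List (List (Tok A) × List (Tok A)) :=
  l.reverse.flatMap fun p => if ∃ q ∈ l, q.1 = p.2 then [p] else []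

theorem mem_keepEdges {l : List (List (Tok A) × List (Tok A))} {p : List (Tok A) × List (Tok A)} :
    p ∈ keepEdges l ↔ p ∈ l ∧ ∃ q ∈ l, q.1 = p.2 := by
  classical
  simp only [keepEdges, List.mem_flatMap, List.mem_reverse]
  constructor
  · rintro ⟨a, ha, hp⟩
    split_ifs at hp with h
    · rw [List.mem_singleton] at hp
      exact hp ▸ ⟨ha, h⟩
    · simp at hp
  · rintro ⟨hp, h⟩
    exact ⟨p, hp, by rw [if_pos h]; simp⟩

/-- Makes the length bound for the initial edge list persist through all rounds. -/
theorem length_encPairs_keepEdges (l : List (List (Tok A) × List (Tok A))) :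
    (encPairs (keepEdges l)).length ≤ (encPairs l).length := by
  classical
  have : ∀ (P : List (Tok A) × List (Tok A) → Prop) (l : List (List (Tok A) × List (Tok A))),
      (encPairs (l.reverse.flatMap fun p => if P p then [p] else [])).length
        ≤ (encPairs l).length := by
    intro P l
    induction l with
    | nil => simp [encPairs]
    | cons p l ih =>
      rw [List.reverse_cons, List.flatMap_append, encPairs_append, List.length_append,
        encPairs_cons]
      by_cases hp : P p <;> simp [encPairs, encPair, hp] at ih ⊢ <;> omega
  convert this (fun p => ∃ q ∈ l, q.1 = p.2) l
  unfold keepEdges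
  congr! 2 with p
  by_cases h : ∃ q ∈ l, q.1 = p.2 <;> simp only [h, if_true, if_false]

/-- Removes from `E` the edges whose end is not the start of an edge. -/
noncomputable def round : Cmd Reg (Tok A) :=
  copy .E .L ;; copy .E .C ;; clear .E ;;
  forPairs (case .G fun | none => nop | some _ => emit .Y .X) ;; clear .C

/-- All stacks other than `E` and `I` are empty. -/
def Clean : Prop := ∀ k, k ≠ .E → k ≠ .I → S k = []

theorem eval_round {l : List (List (Tok A) × List (Tok A))} (hl : PairsFree l)
    (hE : S .E = encPairs l) (hS : Clean S) (hlb : (encPairs l).length ≤ bound N)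
    (hN : 0 < bound N) :
    eval N round S = Function.update S .E (encPairs (keepEdges l)) := by
  classical
  have hS' : ∀ k, k ≠ .E → k ≠ .I → S k = [] := hS
  simp only [round, eval]
  rw [eval_copy (b := .L) _ (by decide) (by decide) (by decide) (hS _ (by decide) (by decide))
      (by rw [hE]; exact hlb),
    eval_copy (b := .C) _ (by decide) (by decide) (by decide) (by simp [hS'])
      (by simpa [hE] using hlb),
    eval_clear (a := .E) _ (by simpa [hE] using hlb),
    eval_forPairs (l := l) (c := l) (e := []) _ (fun y x b => if b then [(y, x)] else []) hl hl
      (by simp [hS', hE]) (by simp [hS', hE]) (by simp [encPairs])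
      (by simp [hS']) (by simp [hS']) (by simp [hS']) (by simp [hS']) (by simp [hS'])
      (by simp [hS']) hN ((length_le_encPairs l).trans hlb)
      (fun p hp => by have := length_of_mem_encPairs hp; omega) hlb
      (by
        intro S' p b hp hY hX hG hR _
        have := length_of_mem_encPairs hp
        cases b
        · simp [eval, hG, encPairs]
        · simp only [eval, hG, flag_true, List.head?_cons]
          rw [eval_emit S' (by decide) (by decide) (by decide) (by decide) hR
            (by rw [hY]; omega) (by rw [hX]; omega), hY, hX]
          simp),
    eval_clear _ (by simpa [hS', hE] using hlb)]
  funext j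
  cases j <;> simp [hS', keepEdges]

theorem eval_rounds (m : ℕ) {l : List (List (Tok A) × List (Tok A))} (hl : PairsFree l)
    (hE : S .E = encPairs l) (hS : Clean S) (hlb : (encPairs l).length ≤ bound N)
    (hN : 0 < bound N) :
    (eval N round)^[m] S = Function.update S .E (encPairs (keepEdges^[m] l)) := by
  induction m generalizing S l with
  | zero => simp [← hE]
  | succ m ih =>
    rw [Function.iterate_succ_apply, Function.iterate_succ_apply, eval_round S hl hE hS hlb hN,
      ih (l := keepEdges l) _ (fun p hp => hl p (mem_keepEdges.1 hp).1) (by simp)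
        (fun k h1 h2 => by simpa [h1] using hS k h1 h2)
        ((length_encPairs_keepEdges l).trans hlb)]
    simp

/-- Checks for edges from the source, and removes all edges. -/
noncomputable def check : Cmd Reg (Tok A) :=
  copy .E .C ;; push .X .src ;; search ;; clear .X ;; clear .C ;; clear .E

theorem sepFree_src : SepFree ([.src] : List (Tok A)) := by simp [SepFree]

open Classical in
theorem eval_check {l : List (List (Tok A) × List (Tok A))} (hl : PairsFree l)
    (hE : S .E = encPairs l) (hS : Clean S) (hlb : (encPairs l).length ≤ bound N)
    (hN : 0 < bound N) :
    eval N check S = Function.update (Function.update S .E []) .G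
      (flag (decide (∃ p ∈ l, p.1 = [.src]))) := by
  have hS' : ∀ k, k ≠ .E → k ≠ .I → S k = [] := hS
  simp only [check, eval]
  rw [eval_copy _ (by decide) (by decide) (by decide) (hS _ (by decide) (by decide))
      (by rw [hE]; exact hlb),
    eval_search _ hl (by simp [hS', hE]) (by simp [hS']) (by simp [hS']) (by simp [hS']) hlb,
    eval_clear (a := .X) _ (by simp [hS']; omega),
    eval_clear (a := .C) _ (by simpa [hS', hE] using hlb),
    eval_clear _ (by simpa [hE] using hlb)]
  funext j
  cases j <;> simp [hS']

end Cmd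

/-! ### Reading numbers, states and positions -/

namespace Cmd

open InputSymbol

variable {A : RankedAlphabet} {N : ℕ} (S : Reg → List (Tok A))

/-- A part of the input as a string of stack entries. -/
def toks (l : List (InputSymbol A)) : List (Tok A) := l.map .inp

@[simp] theorem toks_append (l l' : List (InputSymbol A)) : toks (l ++ l') = toks l ++ toks l' :=
  List.map_append

@[simp] theorem toks_cons (a : InputSymbol A) (l : List (InputSymbol A)) :
    toks (a :: l) = .inp a :: toks l := rfl

@[simp] theorem toks_nil : toks ([] : List (InputSymbol A)) = [] := rfl

@[simp] theorem length_toks (l : List (InputSymbol A)) : (toks l).length = l.length :=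
  List.length_map ..

theorem sepFree_toks (l : List (InputSymbol A)) : SepFree (toks l) := by
  intro x hx
  obtain ⟨a, -, rfl⟩ := List.mem_map.1 hx
  simp

theorem SepFree.reverse {k : List (Tok A)} (h : SepFree k) : SepFree k.reverse :=
  fun x hx => h x (List.mem_reverse.1 hx)

/-- The string that represents a position. -/
def posKey (w : Pos) : List (Tok A) := (toks (w.flatMap fun i => item :: codeNat i)).reverse

/-- The string that represents a state. -/
def stateKey {n : ℕ} (q : Option (Fin n)) : List (Tok A) := (toks (codeState q)).reverse

theorem sepFree_posKey (w : Pos) : SepFree (posKey w : List (Tok A)) := (sepFree_toks _).reverse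

theorem sepFree_stateKey {n : ℕ} (q : Option (Fin n)) : SepFree (stateKey q : List (Tok A)) :=
  (sepFree_toks _).reverse

/-- Moves a number from the input to `k`. -/
def readNum (k : Reg) : Cmd Reg (Tok A) :=
  rep (case .I fun | some (Tok.inp (bit b)) => mv .I k (.inp (bit b)) | _ => nop) ;;
    mv .I k (.inp close)

/-- Moves a state from the input to `k`. -/
def readState (k : Reg) : Cmd Reg (Tok A) :=
  case .I fun | some (Tok.inp bot) => mv .I k (.inp bot) | _ => readNum k

/-- Moves a position from the input to `k`. -/
def readPos (k : Reg) : Cmd Reg (Tok A) :=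
  rep (case .I fun | some (Tok.inp item) => mv .I k (.inp item) ;; readNum k | _ => nop) ;; pop .I

theorem eval_readNum {k : Reg} (hk : k ≠ .I) {m : ℕ} {rest : List (Tok A)}
    (hI : S .I = toks (codeNat m) ++ rest) (hl : (codeNat m : List (InputSymbol A)).length ≤ bound N) :
    eval N (readNum k) S
      = Function.update (Function.update S .I rest) k ((toks (codeNat m)).reverse ++ S k) := by
  have hmem : ∀ x ∈ toks ((Computability.encodeNat m).map (bit : Bool → InputSymbol A)),
      ∃ b, x = Tok.inp (bit b) := by
    intro x hx
    simp only [toks, List.map_map, List.mem_map, Function.comp_apply] at hx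
    obtain ⟨b, -, rfl⟩ := hx
    exact ⟨b, rfl⟩
  have := eval_rep_foldl (N := N)
    (c := case .I fun | some (Tok.inp (bit b)) => mv .I k (.inp (bit b)) | _ => nop)
    (fun acc l => Function.update (Function.update S .I (l ++ .inp close :: rest)) k acc)
    (fun acc x => x :: acc) (toks ((Computability.encodeNat m).map bit)) (S k)
    (by
      intro acc x l hx
      obtain ⟨b, rfl⟩ := hmem x hx
      funext j
      simp only [eval, mv, Function.update_apply, hk, hk.symm, if_true, if_false, List.cons_append,
        List.head?_cons, List.tail_cons]
      split_ifs <;> simp_all)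
    (by
      intro acc
      simp [eval, hk.symm]) (by simp [codeNat] at hl ⊢; omega)
  rw [foldl_cons] at this
  have e : S .I = toks ((Computability.encodeNat m).map bit) ++ .inp close :: rest := by
    simpa [codeNat] using hI
  rw [← e] at this
  simp only [Function.update_eq_self] at this
  simp only [readNum, eval]
  rw [this]
  simp only [mv, eval]
  funext j
  simp only [Function.update_apply, hk, hk.symm, if_true, if_false, codeNat]
  split_ifs <;> simp_all

theorem head?_codeNat (m : ℕ) : ∃ a : InputSymbol A, (codeNat m).head? = some a ∧
    ((∃ b, a = bit b) ∨ a = close) := by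
  rw [codeNat]
  cases Computability.encodeNat m with
  | nil => exact ⟨close, rfl, .inr rfl⟩
  | cons b l => exact ⟨bit b, rfl, .inl ⟨b, rfl⟩⟩

theorem head?_toks_append {l : List (InputSymbol A)} {a : InputSymbol A} (h : l.head? = some a)
    (r : List (Tok A)) : (toks l ++ r).head? = some (.inp a) := by
  obtain ⟨l', rfl⟩ := List.head?_eq_some_iff.1 h
  rfl

theorem eval_readState {k : Reg} (hk : k ≠ .I) {n : ℕ} {q : Option (Fin n)} {rest : List (Tok A)}
    (hI : S .I = toks (codeState q) ++ rest)
    (hl : (codeState q : List (InputSymbol A)).length ≤ bound N) :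
    eval N (readState k) S
      = Function.update (Function.update S .I rest) k (stateKey q ++ S k) := by
  rcases q with _ | i
  · simp only [readState, eval, hI, codeState, toks_cons, toks_nil, List.cons_append,
      List.nil_append, List.head?_cons, mv]
    simp [hk, stateKey, codeState]
  · obtain ⟨a, ha, h⟩ := head?_codeNat (A := A) i.val
    have := head?_toks_append ha rest
    simp only [codeState] at hI hl
    simp only [readState, eval, hI, this]
    rcases h with ⟨b, rfl⟩ | rfl <;> exact eval_readNum S hk hI hl

theorem foldl_reverse_append {α β : Type} (f : α → List β) (l : List α) (b : List β) :
    l.foldl (fun acc i => (f i).reverse ++ acc) b = (l.flatMap f).reverse ++ b := by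
  induction l generalizing b with
  | nil => rfl
  | cons a l ih => simp [ih]

theorem toks_flatMap {α : Type} (f : α → List (InputSymbol A)) (l : List α) :
    toks (l.flatMap f) = l.flatMap fun i => toks (f i) := by
  simp [toks, List.map_flatMap]

theorem eval_readPos {k : Reg} (hk : k ≠ .I) {w : Pos} {rest : List (Tok A)}
    (hI : S .I = toks (codePos w) ++ rest)
    (hl : (codePos w : List (InputSymbol A)).length ≤ bound N) :
    eval N (readPos k) S
      = Function.update (Function.update S .I rest) k (posKey w ++ S k) := by
  have hlen : ∀ i ∈ w, (codeNat i : List (InputSymbol A)).length ≤ bound N ∧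
      w.length ≤ bound N := by
    intro i hi
    obtain ⟨s, t, rfl⟩ := List.append_of_mem hi
    have h (l : List ℕ) : l.length ≤ (l.flatMap fun i => (item : InputSymbol A) :: codeNat i).length := by
      induction l with
      | nil => simp
      | cons a l ih => rw [List.flatMap_cons]; simp at ih ⊢; omega
    have h1 := h s
    have h2 := h t
    simp only [codePos, codeList, List.flatMap_append, List.flatMap_cons, List.length_append,
      List.length_cons] at hl ⊢
    omega
  have := eval_rep_foldl (N := N)
    (c := case .I fun | some (Tok.inp item) => mv .I k (.inp item) ;; readNum k | _ => nop)
    (fun acc (l : Pos) => Function.update (Function.update S .I (toks (codePos l) ++ rest)) k acc)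
    (fun acc i => (toks (item :: codeNat i)).reverse ++ acc) w (S k)
    (by
      intro acc i l hi
      have e : toks (codePos (i :: l)) ++ rest
          = (.inp item :: (toks (codeNat i) ++ (toks (codePos l) ++ rest)) : List (Tok A)) := by
        simp [codePos, codeList]
      simp only [eval, mv, e, Function.update_of_ne hk.symm, Function.update_self, List.head?_cons]
      rw [eval_readNum _ hk (m := i) (rest := toks (codePos l) ++ rest) (by simp [hk.symm])
        (hlen i hi).1]
      funext j
      simp only [Function.update_apply]
      split_ifs <;> simp_all)
    (by
      intro acc
      simp [eval, hk.symm, codePos, codeList])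
    (by
      rcases w with _ | ⟨i, w⟩
      · simp
      · exact (hlen i (by simp)).2)
  rw [← hI] at this
  rw [foldl_reverse_append] at this
  simp only [Function.update_eq_self] at this
  simp only [readPos, eval, this]
  funext j
  simp only [Function.update_apply, hk.symm, if_true, if_false, posKey, toks_flatMap]
  split_ifs <;> simp_all [codePos, codeList]

/-! ### The path stack, which tracks the position while a tree is read -/

/-- The number of the subtree to which an entry of the path stack refers. -/
def digit : Tok A → Option ℕ
  | .dir _ i => some i.val
  | _ => none

/-- The position to which the path stack refers. -/
def posOf (p : List (Tok A)) : Pos := p.reverse.filterMap digit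

/-- Pushes a constant string. -/
def pushAll (k : Reg) : List (Tok A) → Cmd Reg (Tok A)
  | [] => nop
  | a :: l => push k a ;; pushAll k l

theorem eval_pushAll (k : Reg) (l : List (Tok A)) :
    eval N (pushAll k l) S = Function.update S k (l.reverse ++ S k) := by
  induction l generalizing S with
  | nil => simp [pushAll, eval]
  | cons a l ih => simp [pushAll, eval, ih]

/-- The code of an entry of the path stack. -/
def digitCode (d : Tok A) : List (Tok A) :=
  match digit d with
  | some i => toks (item :: codeNat i)
  | none => []

theorem flatMap_digitCode (p : List (Tok A)) :
    p.flatMap digitCode = toks ((p.filterMap digit).flatMap fun i => item :: codeNat i) := by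
  induction p with
  | nil => rfl
  | cons d p ih =>
    rw [List.flatMap_cons, ih, List.filterMap_cons, digitCode]
    cases digit d <;> simp

/-- Writes the current position to `L`. -/
def copyPath : Cmd Reg (Tok A) :=
  move .P .R ;; rep (case .R fun
    | some d => pop .R ;; push .P d ;; pushAll .L (digitCode d)
    | none => nop)

theorem eval_copyPath (hR : S .R = []) (hP : (S .P).length ≤ bound N) :
    eval N copyPath S = Function.update S .L (posKey (posOf (S .P)) ++ S .L) := by
  have := eval_rep_foldl (N := N)
    (c := case .R fun
      | some d => pop .R ;; push .P d ;; pushAll .L (digitCode d)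
      | none => nop)
    (fun acc (l : List (Tok A)) => Function.update (Function.update (Function.update S .P acc.1)
      .R l) .L acc.2)
    (fun acc d => (d :: acc.1, (digitCode d).reverse ++ acc.2)) (S .P).reverse ([], S .L)
    (by
      intro acc d l _
      simp only [eval, ne_eq, reduceCtorEq, not_false_eq_true, Function.update_of_ne,
        Function.update_self, List.head?_cons, eval_pushAll]
      funext j
      cases j <;> simp)
    (by
      intro acc
      simp [eval])
    (by simpa using hP)
  have fold : ∀ (l : List (Tok A)) (acc : List (Tok A) × List (Tok A)),
      l.foldl (fun acc d => (d :: acc.1, (digitCode d).reverse ++ acc.2)) acc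
        = (l.reverse ++ acc.1, (l.flatMap digitCode).reverse ++ acc.2) := by
    intro l
    induction l with
    | nil => intro acc; rfl
    | cons a l ih => intro acc; simp [ih]
  rw [fold, flatMap_digitCode] at this
  simp only [List.reverse_reverse, List.append_nil] at this
  simp only [copyPath, eval]
  rw [eval_move _ (by decide) hP]
  convert this using 2
  · funext j
    cases j <;> simp [hR]
  · funext j
    cases j <;> simp [hR]
  · rfl

/-- The path stack after the subtree to which it refers has been read. -/
def nextPath : List (Tok A) → List (Tok A)
  | .dir s i :: p => if h : i.val + 1 < A.rank s then .dir s ⟨i.val + 1, h⟩ :: p else nextPath p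
  | .root :: p => p
  | p => p

/-- Removes the entry of the last subtree of a node from the path stack. -/
def ascend : Cmd Reg (Tok A) :=
  case .P fun
    | some (.dir s i) => if i.val + 1 < A.rank s then nop else pop .P
    | _ => nop

/-- Replaces the path stack by the one for the next subtree. -/
def advance : Cmd Reg (Tok A) :=
  rep ascend ;;
  case .P fun
    | some (Tok.dir s i) => pop .P ;; if h : i.val + 1 < A.rank s then push .P (.dir s ⟨i.val + 1, h⟩)
        else nop
    | some Tok.root => pop .P
    | _ => nop

/-- The entry refers to the last subtree of a node. -/
def IsLast (d : Tok A) : Prop := ∃ s i, d = .dir s i ∧ ¬ i.val + 1 < A.rank s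

theorem exists_isLast_append (p : List (Tok A)) :
    ∃ l p', p = l ++ p' ∧ (∀ d ∈ l, IsLast d) ∧ ∀ d ∈ p'.head?, ¬ IsLast d := by
  induction p with
  | nil => exact ⟨[], [], rfl, by simp, by simp⟩
  | cons d p ih =>
    by_cases h : IsLast d
    · obtain ⟨l, p', rfl, h1, h2⟩ := ih
      exact ⟨d :: l, p', rfl, by simpa using ⟨h, h1⟩, h2⟩
    · exact ⟨[], d :: p, rfl, by simp, by simpa using h⟩

theorem nextPath_append {l : List (Tok A)} (hl : ∀ d ∈ l, IsLast d) (p : List (Tok A)) :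
    nextPath (l ++ p) = nextPath p := by
  induction l with
  | nil => rfl
  | cons d l ih =>
    obtain ⟨s, i, rfl, h⟩ := hl d (by simp)
    rw [List.cons_append, nextPath, dif_neg h]
    exact ih fun d hd => hl d (by simp [hd])

/-- The path works like an odometer: entries that stand at a last child are dropped, and then the
first other entry is increased, or the root marker removed. -/
theorem eval_advance (hP : (S .P).length ≤ bound N) :
    eval N advance S = Function.update S .P (nextPath (S .P)) := by
  obtain ⟨l, p, hp, hl, hp'⟩ := exists_isLast_append (S .P)
  have := eval_rep_foldl (N := N) (c := ascend)
    (fun (_ : Unit) l => Function.update S .P (l ++ p)) (fun _ _ => ()) l ()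
    (by
      intro _ d l' hd
      obtain ⟨s, i, rfl, h⟩ := hl d hd
      simp [ascend, eval, h])
    (by
      intro _
      rcases p with _ | ⟨d, p⟩
      · simp [ascend, eval]
      · simp only [List.head?_cons, Option.mem_def, Option.some.injEq, forall_eq'] at hp'
        cases d <;> simp only [ascend, eval, List.nil_append, Function.update_self, List.head?_cons]
        rename_i s i
        have : i.val + 1 < A.rank s := by
          by_contra h
          exact hp' ⟨s, i, rfl, h⟩
        rw [if_pos this]
        rfl)
    (by rw [hp] at hP; simp at hP; omega)
  rw [← hp, Function.update_eq_self] at this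
  simp only [advance, eval]
  rw [this, hp, nextPath_append hl]
  rcases p with _ | ⟨d, p⟩
  · simp [eval, nextPath]
  · simp only [List.head?_cons, Option.mem_def, Option.some.injEq, forall_eq'] at hp'
    cases d <;> simp [eval, nextPath]
    rename_i s i
    have : i.val + 1 < A.rank s := by
      by_contra h
      exact hp' ⟨s, i, rfl, h⟩
    simp [this, eval]

end Cmd

/-! ### Reading trees -/

namespace Cmd

open InputSymbol

variable {A : RankedAlphabet} {N : ℕ} (S : Reg → List (Tok A))

/-- Reads one entry of a tree. -/
def treeBody : Cmd Reg (Tok A) :=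
  case .P fun
    | none => nop
    | some _ => case .I fun
      | some (.inp (sym s)) =>
        pop .I ;; if h : 0 < A.rank s then push .P (.dir s ⟨0, h⟩) else advance
      | _ => push .L .sep ;; copyPath ;; push .L .sep ;; readState .L ;; advance

/-- Reads a tree, and writes its leaves to `L`. -/
def readTree : Cmd Reg (Tok A) := push .P .root ;; rep treeBody

/-- The leaves of a tree in reverse order, with their positions behind the prefix `w`. -/
def leaves {n : ℕ} : RTree A (Option (Fin n)) → Pos → List (Option (Fin n) × Pos)
  | .leaf q, w => [(q, w)]
  | .node _ ts, w => (List.ofFn fun i => leaves (ts i) (w ++ [i.val])).flatten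

/-- The strings that represent a leaf. -/
def leafPair {n : ℕ} (x : Option (Fin n) × Pos) : List (Tok A) × List (Tok A) :=
  (stateKey x.1, posKey x.2)

theorem eval_treeBody_leaf {n : ℕ} {q : Option (Fin n)} {rest : List (Tok A)} (hP : S .P ≠ [])
    (hI : S .I = toks (codeState q) ++ rest) (hR : S .R = []) (hPl : (S .P).length ≤ bound N)
    (hl : (codeState q : List (InputSymbol A)).length ≤ bound N) :
    eval N treeBody S = Function.update (Function.update (Function.update S .I rest)
      .P (nextPath (S .P))) .L (encPairs [leafPair (q, posOf (S .P))] ++ S .L) := by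
  obtain ⟨d, p, hp⟩ := List.exists_cons_of_ne_nil hP
  have key : eval N (push .L .sep ;; copyPath ;; push .L .sep ;; readState .L ;; advance) S =
      Function.update (Function.update (Function.update S .I rest)
      .P (nextPath (S .P))) .L (encPairs [leafPair (q, posOf (S .P))] ++ S .L) := by
    simp only [eval]
    rw [eval_copyPath _ (by simpa using hR) (by simpa using hPl),
      eval_readState (q := q) (rest := rest) _ (by decide) (by simpa using hI) hl,
      eval_advance _ (by simpa using hPl)]
    funext j
    cases j <;> simp [leafPair, encPairs, encPair]
  rw [← key]
  have : ∃ a, (S .I).head? = some (.inp a) ∧ ∀ s, a ≠ sym s := by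
    rw [hI]
    rcases q with _ | i
    · exact ⟨bot, rfl, by simp⟩
    · obtain ⟨a, ha, h⟩ := head?_codeNat (A := A) i.val
      exact ⟨a, head?_toks_append ha rest, by rcases h with ⟨b, rfl⟩ | rfl <;> simp⟩
  obtain ⟨a, ha, has⟩ := this
  rw [treeBody]
  simp only [eval, hp, List.head?_cons, ha]
  cases a <;> first | rfl | exact absurd rfl (has _)

theorem eval_treeBody_node {s : A.Sym} {rest : List (Tok A)} (hP : S .P ≠ [])
    (hI : S .I = .inp (sym s) :: rest) (hPl : (S .P).length ≤ bound N) :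
    eval N treeBody S = Function.update (Function.update S .I rest)
      .P (if h : 0 < A.rank s then .dir s ⟨0, h⟩ :: S .P else nextPath (S .P)) := by
  obtain ⟨d, p, hp⟩ := List.exists_cons_of_ne_nil hP
  simp only [treeBody, eval, hp, List.head?_cons, hI, List.tail_cons]
  split_ifs with h
  · simp [eval, hp]
  · rw [eval_advance _ (by simpa using hPl)]
    simp [hp]

theorem posOf_dir_cons (s : A.Sym) (i : Fin (A.rank s)) (p : List (Tok A)) :
    posOf (.dir s i :: p) = posOf p ++ [i.val] := by
  simp [posOf, digit]

/-- One iteration handles one node. The bound on path length plus code length survives a descent, as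
the path grows by one entry and the code of a child is shorter than that of its parent. At the root,
`nextPath` yields the empty path, on which `treeBody` idles. -/
theorem eval_treeBody_iterate {n : ℕ} (t : RTree A (Option (Fin n))) :
    ∀ (S : Reg → List (Tok A)) (rest : List (Tok A)), S .P ≠ [] →
      S .I = toks (codeTree t) ++ rest → S .R = [] →
      (S .P).length + (codeTree t).length ≤ bound N →
      ∃ m ≤ (codeTree t).length, (eval N treeBody)^[m] S =
        Function.update (Function.update (Function.update S .I rest) .P (nextPath (S .P)))
          .L (encPairs ((leaves t (posOf (S .P))).reverse.map leafPair) ++ S .L) := by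
  induction t with
  | leaf q =>
    intro S rest hP hI hR hl
    have h1 : 1 ≤ (codeState q : List (InputSymbol A)).length := by
      rcases q with _ | i <;> simp [codeState, codeNat]
    simp only [codeTree] at hI hl ⊢
    refine ⟨1, h1, ?_⟩
    rw [Function.iterate_one, eval_treeBody_leaf S hP hI hR (by omega) (by omega)]
    rfl
  | node s ts ih =>
    intro S rest hP hI hR hl
    set cs := List.ofFn fun i => (codeTree (ts i) : List (InputSymbol A)) with hcs
    set ls := List.ofFn fun i => leaves (ts i) (posOf (S .P) ++ [i.val]) with hls
    -- The path after `j` children have been read. At `j = rank s` it has already moved past the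
    -- node, which also covers symbols of rank 0.
    set path : ℕ → List (Tok A) := fun j =>
      if h : j < A.rank s then .dir s ⟨j, h⟩ :: S .P else nextPath (S .P) with hpath
    have hcode : codeTree (RTree.node s ts) = sym s :: cs.flatten := by rw [codeTree]
    rw [hcode, List.length_cons] at hl
    have hcl : cs.length = A.rank s := by simp [hcs]
    have hll : ls.length = A.rank s := by simp [hls]
    have key : ∀ j ≤ A.rank s, ∃ m ≤ 1 + (cs.take j).flatten.length, (eval N treeBody)^[m] S =
        Function.update (Function.update (Function.update S
          .I (toks (cs.drop j).flatten ++ rest)) .P (path j))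
          .L (encPairs ((ls.take j).flatten.reverse.map leafPair) ++ S .L) := by
      intro j
      induction j with
      | zero =>
        intro _
        refine ⟨1, by simp, ?_⟩
        rw [Function.iterate_one, eval_treeBody_node S hP (s := s) (rest := toks cs.flatten ++ rest)
          (by rw [hI, hcode]; rfl) (by omega)]
        funext k
        cases k <;> simp [hpath, encPairs]
      | succ j ihj =>
        intro hj
        obtain ⟨m, hm, e⟩ := ihj (by omega)
        have hj' : j < A.rank s := by omega
        have hpj : path j = .dir s ⟨j, hj'⟩ :: S .P := by simp only [hpath]; rw [dif_pos hj']
        have hpj' : nextPath (path j) = path (j + 1) := by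
          rw [hpj, nextPath]
        have hdrop : cs.drop j = codeTree (ts ⟨j, hj'⟩) :: cs.drop (j + 1) := by
          rw [List.drop_eq_getElem_cons (by omega)]
          simp [hcs]
        have htake : cs.take (j + 1) = cs.take j ++ [codeTree (ts ⟨j, hj'⟩)] := by
          rw [List.take_succ_eq_append_getElem (by omega)]
          simp [hcs]
        have htake' : ls.take (j + 1) = ls.take j ++
            [leaves (ts ⟨j, hj'⟩) (posOf (S .P) ++ [j])] := by
          rw [List.take_succ_eq_append_getElem (by omega)]
          simp [hls]
        have hle : (codeTree (ts ⟨j, hj'⟩) : List (InputSymbol A)).length ≤ cs.flatten.length := by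
          refine (List.sublist_flatten_of_mem ?_).length_le
          rw [hcs, List.mem_ofFn]
          exact ⟨_, rfl⟩
        obtain ⟨m', hm', e'⟩ := ih ⟨j, hj'⟩ (Function.update (Function.update (Function.update S
          .I (toks (cs.drop j).flatten ++ rest)) .P (path j))
          .L (encPairs ((ls.take j).flatten.reverse.map leafPair) ++ S .L))
          (toks (cs.drop (j + 1)).flatten ++ rest) (by simp [hpj]) (by simp [hdrop])
          (by simpa using hR) (by simp [hpj]; omega)
        refine ⟨m' + m, ?_, ?_⟩
        · rw [htake, List.flatten_append, List.length_append, List.flatten_singleton]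
          omega
        · rw [Function.iterate_add_apply, e, e']
          simp only [ne_eq, reduceCtorEq, not_false_eq_true, Function.update_of_ne,
            Function.update_self, hpj']
          rw [hpj, posOf_dir_cons, htake']
          funext k
          cases k <;> simp [encPairs_append]
    obtain ⟨m, hm, e⟩ := key (A.rank s) le_rfl
    refine ⟨m, ?_, ?_⟩
    · rw [hcode, List.length_cons]
      rw [← hcl, List.take_length] at hm
      omega
    · rw [e, ← hcl, List.drop_length, hcl, ← hll, List.take_length, hll]
      funext k
      cases k <;> simp [hpath, leaves, hls]

theorem eval_readTree {n : ℕ} {t : RTree A (Option (Fin n))} {rest : List (Tok A)}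
    (hP : S .P = []) (hI : S .I = toks (codeTree t) ++ rest) (hR : S .R = [])
    (hl : (codeTree t : List (InputSymbol A)).length + 1 ≤ bound N) :
    eval N readTree S = Function.update (Function.update S .I rest)
      .L (encPairs ((leaves t []).reverse.map leafPair) ++ S .L) := by
  obtain ⟨m, hm, e⟩ := eval_treeBody_iterate (N := N) t (Function.update S .P [.root]) rest
    (by simp) (by simpa using hI) (by simpa using hR) (by simp; omega)
  simp only [readTree, eval, hP]
  rw [eval_rep_of_iterate e (by simp [treeBody, eval, nextPath]) (by omega)]
  funext k
  cases k <;> simp [hP, nextPath, posOf, List.filterMap_cons, digit]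

end Cmd

/-! ### Reading constraints, and the edges of a leaf -/

namespace Cmd

open InputSymbol

variable {A : RankedAlphabet} {N : ℕ} (S : Reg → List (Tok A))

theorem append_close_inj {l l' : List Bool} {r r' : List (InputSymbol A)}
    (h : l.map bit ++ close :: r = l'.map bit ++ close :: r') : l = l' ∧ r = r' := by
  induction l generalizing l' with
  | nil => cases l' with
    | nil => simpa using h
    | cons b l' => simp at h
  | cons a l ih => cases l' with
    | nil => simp at h
    | cons b l' =>
      simp only [List.map_cons, List.cons_append, List.cons.injEq, bit.injEq] at h
      obtain ⟨rfl, rfl⟩ := ih h.2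
      exact ⟨by rw [h.1], rfl⟩

/-- The end marker makes the codes of numbers prefix-free; hence positions can be compared as
strings. -/
theorem codeNat_append_inj {i j : ℕ} {r r' : List (InputSymbol A)}
    (h : codeNat i ++ r = codeNat j ++ r') : i = j ∧ r = r' := by
  simp only [codeNat, List.append_assoc, List.cons_append, List.nil_append] at h
  obtain ⟨h1, h2⟩ := append_close_inj h
  exact ⟨by simpa using congrArg Computability.decodeNat h1, h2⟩

theorem toks_injective : Function.Injective (toks : List (InputSymbol A) → List (Tok A)) :=
  List.map_injective_iff.2 fun _ _ h => by simpa using h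

theorem posKey_injective : Function.Injective (posKey : Pos → List (Tok A)) := by
  intro w x h'
  have h := toks_injective (List.reverse_injective h')
  clear h'
  induction w generalizing x with
  | nil => cases x with
    | nil => rfl
    | cons j x => simp at h
  | cons i w ih => cases x with
    | nil => simp at h
    | cons j x =>
      simp only [List.flatMap_cons, List.cons_append, List.cons.injEq, true_and] at h
      obtain ⟨hij, h'⟩ := codeNat_append_inj h
      rw [hij, ih h']

theorem stateKey_injective {n : ℕ} :
    Function.Injective (stateKey : Option (Fin n) → List (Tok A)) := by
  intro p q h
  have h := toks_injective (List.reverse_injective h)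
  have hbot (i : ℕ) : (codeNat i : List (InputSymbol A)) ≠ [bot] := by
    intro h
    obtain ⟨a, ha, h'⟩ := head?_codeNat (A := A) i
    rw [h] at ha
    rcases h' with ⟨b, rfl⟩ | rfl <;> simp at ha
  rcases p with _ | i <;> rcases q with _ | j
  · rfl
  · exact absurd h.symm (hbot _)
  · exact absurd h (hbot _)
  · simp only [codeState] at h
    have := (codeNat_append_inj (r := []) (r' := []) (by simpa using h)).1
    rw [Fin.ext this]

/-- Reads a constraint. The first position is recorded in `D` if the positions are distinct. -/
noncomputable def readConstr : Cmd Reg (Tok A) :=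
  readPos .X ;; push .C .sep ;; push .C .sep ;; readPos .C ;; search ;;
  (case .G fun
    | none => push .D .sep ;; push .D .sep ;; copy .X .D
    | some _ => nop) ;;
  clear .X ;; clear .C ;; clear .G

/-- The record for a constraint. -/
def constrPairs (c : Pos × Pos) : List (List (Tok A) × List (Tok A)) :=
  if c.1 = c.2 then [] else [(posKey c.1, [])]

theorem length_posKey (w : Pos) :
    (posKey w : List (Tok A)).length + 1 = (codePos w : List (InputSymbol A)).length := by
  simp [posKey, codePos, codeList]

/-- The second position is laid out in `C` as a list with one pair, so that `search` serves as an
equality test. Recording first positions only is enough, as the constraints of a WTGh are symmetric.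
-/
theorem eval_readConstr {w x : Pos} {rest : List (Tok A)}
    (hI : S .I = toks (codePos w ++ codePos x) ++ rest) (hX : S .X = []) (hC : S .C = [])
    (hC2 : S .C2 = []) (hX2 : S .X2 = []) (hG : S .G = []) (hR : S .R = [])
    (hl : (codePos w ++ codePos x : List (InputSymbol A)).length ≤ bound N) :
    eval N readConstr S = Function.update (Function.update S .I rest) .D
      (encPairs (constrPairs (w, x)) ++ S .D) := by
  classical
  have hw := length_posKey (A := A) w
  have hx := length_posKey (A := A) x
  rw [List.length_append] at hl
  have henc : (encPairs [((posKey x : List (Tok A)), [])]).length ≤ bound N := by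
    simp [encPairs, encPair]
    omega
  simp only [readConstr, eval]
  rw [eval_readPos (k := .X) (w := w) (rest := toks (codePos x) ++ rest) _ (by decide)
      (by simpa using hI) (by omega),
    eval_readPos (k := .C) (w := x) (rest := rest) _ (by decide) (by simp) (by omega),
    eval_search (l := [(posKey x, [])]) _
      (by simpa [SepFree] using sepFree_posKey x)
      (by simp [encPairs, encPair, hC]) (by simp [hC2]) (by simp [hX2])
      (by simp [hG]) henc]
  have hkey : (∃ p ∈ [((posKey x : List (Tok A)), ([] : List (Tok A)))], p.1 = posKey w) ↔ w = x := by
    simp [posKey_injective.eq_iff, eq_comm]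
  simp only [ne_eq, reduceCtorEq, not_false_eq_true, Function.update_of_ne, Function.update_self, hX,
    List.append_nil, hkey]
  by_cases hwx : w = x
  · simp only [hwx, decide_true, flag_true, List.head?_cons, eval]
    rw [eval_clear (a := .X) _ (by simp; omega),
      eval_clear (a := .C) _ (by simpa [hC, encPairs, encPair] using henc),
      eval_clear (a := .G) _ (by simp; omega)]
    funext j
    cases j <;> simp [hX, hC, hG, constrPairs, encPairs]
  · simp only [hwx, decide_false, flag_false, List.head?_nil, eval]
    rw [eval_copy (a := .X) (b := .D) _ (by decide) (by decide) (by decide) (by simp [hR])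
        (by simp; omega),
      eval_clear (a := .X) _ (by simp; omega),
      eval_clear (a := .C) _ (by simpa [hC, encPairs, encPair] using henc),
      eval_clear (a := .G) _ (by simp)]
    funext j
    cases j <;> simp [hX, hC, hG, constrPairs, encPairs, encPair, hwx]

/-- Reads one constraint of a list. -/
noncomputable def constrBody : Cmd Reg (Tok A) :=
  case .I fun
    | some (.inp item) => pop .I ;; readConstr
    | _ => nop

/-- Reads a list of constraints to `C`. -/
noncomputable def readConstrs : Cmd Reg (Tok A) := rep constrBody ;; pop .I ;; copy .D .C ;; clear .D

/-- The code of a constraint. -/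
def codeConstr (e : Pos × Pos) : List (InputSymbol A) := codePos e.1 ++ codePos e.2

theorem codeList_cons {α : Type} (f : α → List (InputSymbol A)) (a : α) (l : List α) :
    codeList f (a :: l) = item :: (f a ++ codeList f l) := by
  simp [codeList]

theorem length_le_codeList {α : Type} (f : α → List (InputSymbol A)) (l : List α) :
    l.length ≤ (codeList f l).length := by
  induction l with
  | nil => simp
  | cons a l ih => rw [codeList_cons]; simp; omega

theorem length_mem_codeList {α : Type} (f : α → List (InputSymbol A)) {l : List α} {a : α}
    (h : a ∈ l) : (f a).length + 2 ≤ (codeList f l).length := by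
  obtain ⟨s, t, rfl⟩ := List.append_of_mem h
  simp [codeList]
  omega

theorem length_encPairs_constrs (es : List (Pos × Pos)) :
    (encPairs (es.reverse.flatMap constrPairs : List (List (Tok A) × List (Tok A)))).length
      ≤ (codeList codeConstr es : List (InputSymbol A)).length := by
  induction es with
  | nil => simp [encPairs]
  | cons e es ih =>
    have hw := length_posKey (A := A) e.1
    have hx := length_posKey (A := A) e.2
    rw [codeList_cons, List.reverse_cons, List.flatMap_append, encPairs_append, List.length_append,
      List.length_cons, List.length_append, codeConstr, List.length_append]
    have : (encPairs ([e].flatMap constrPairs : List (List (Tok A) × List (Tok A)))).length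
        ≤ (codePos e.1 : List (InputSymbol A)).length + (codePos e.2 : List (InputSymbol A)).length := by
      by_cases h : e.1 = e.2 <;> simp [constrPairs, h, encPairs, encPair]
      omega
    omega

theorem eval_readConstrs {es : List (Pos × Pos)} {rest : List (Tok A)}
    (hI : S .I = toks (codeList codeConstr es) ++ rest) (hX : S .X = []) (hC : S .C = [])
    (hC2 : S .C2 = []) (hX2 : S .X2 = []) (hG : S .G = []) (hR : S .R = []) (hD : S .D = [])
    (hl : (codeList codeConstr es : List (InputSymbol A)).length ≤ bound N) :
    eval N readConstrs S = Function.update (Function.update S .I rest) .C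
      (encPairs (es.reverse.flatMap constrPairs)) := by
  have := eval_rep_foldl (N := N) (c := constrBody)
    (fun acc (l : List (Pos × Pos)) => Function.update (Function.update S
      .I (toks (codeList codeConstr l) ++ rest)) .D acc)
    (fun acc e => encPairs (constrPairs e) ++ acc) es []
    (by
      intro acc e l he
      have hlen := length_mem_codeList (codeConstr (A := A)) he
      simp only [constrBody, eval, ne_eq, reduceCtorEq, not_false_eq_true, Function.update_of_ne,
        Function.update_self, codeList_cons, toks_cons, toks_append, List.cons_append,
        List.head?_cons, List.tail_cons]
      rw [eval_readConstr (w := e.1) (x := e.2) (rest := toks (codeList codeConstr l) ++ rest) _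
        (by simp [codeConstr]) (by simp [hX]) (by simp [hC]) (by simp [hC2]) (by simp [hX2])
        (by simp [hG]) (by simp [hR]) (by rw [← codeConstr]; omega)]
      funext j
      cases j <;> simp)
    (by
      intro acc
      simp [constrBody, eval, codeList])
    ((length_le_codeList codeConstr es).trans hl)
  rw [← hI, ← hD] at this
  simp only [Function.update_eq_self] at this
  have fold : ∀ (l : List (Pos × Pos)) (acc : List (Tok A)),
      l.foldl (fun acc e => encPairs (constrPairs e) ++ acc) acc
        = encPairs (l.reverse.flatMap constrPairs) ++ acc := by
    intro l
    induction l with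
    | nil => intro acc; simp [encPairs]
    | cons e l ih => intro acc; rw [List.foldl_cons, ih]; simp [encPairs_append]
  rw [fold, hD, List.append_nil] at this
  have hb := (length_encPairs_constrs (A := A) es).trans hl
  simp only [readConstrs, eval]
  rw [this, eval_copy (a := .D) (b := .C) _ (by decide) (by decide) (by decide) (by simp [hR])
      (by simpa using hb),
    eval_clear (a := .D) _ (by simpa using hb)]
  funext j
  cases j <;> simp [hC, hD, codeList]

/-- Adds the edge from the source to the string in `Y`. -/
def emitSrc : Cmd Reg (Tok A) := push .E .sep ;; copy .Y .E ;; push .E .sep ;; push .E .src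

/-- Adds the edges for a leaf to `E`. -/
def emitLeaf : Cmd Reg (Tok A) :=
  case .Y fun
    | some (.inp bot) => case .G fun | none => emit .T .T | some _ => nop
    | _ => emit .T .Y ;; case .G fun | none => nop | some _ => emitSrc

/-- The edges for a leaf with the state `y` of a production with the target `x`. -/
def leafEdges {n : ℕ} (x y : Option (Fin n)) (b : Bool) : List (List (Tok A) × List (Tok A)) :=
  match y, b with
  | none, false => [(stateKey x, stateKey x)]
  | none, true => []
  | some i, false => [(stateKey x, stateKey (some i))]
  | some i, true => [([.src], stateKey (some i)), (stateKey x, stateKey (some i))]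

theorem head?_stateKey_none {n : ℕ} :
    (stateKey (none : Option (Fin n)) : List (Tok A)).head? = some (.inp bot) := rfl

/-- Keys are reversed codes, so the end marker of the number is on top. One look at the top entry
therefore separates proper states from `⊥`. -/
theorem head?_stateKey_some {n : ℕ} (i : Fin n) :
    (stateKey (some i) : List (Tok A)).head? = some (.inp close) := by
  simp [stateKey, codeState, codeNat]

theorem eval_emitTT (hR : S .R = []) (hT : (S .T).length ≤ bound N) :
    eval N (emit .T .T) S = Function.update S .E (encPairs [(S .T, S .T)] ++ S .E) :=
  eval_emit S (by decide) (by decide) (by decide) (by decide) hR hT hT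

theorem eval_emitLeaf {n : ℕ} {x y : Option (Fin n)} {b : Bool} (hY : S .Y = stateKey y)
    (hT : S .T = stateKey x) (hG : S .G = flag b) (hR : S .R = [])
    (hx : (stateKey x : List (Tok A)).length ≤ bound N)
    (hy : (stateKey y : List (Tok A)).length ≤ bound N) :
    eval N emitLeaf S = Function.update S .E (encPairs (leafEdges x y b) ++ S .E) := by
  rcases y with _ | i
  · simp only [emitLeaf, eval, hY, head?_stateKey_none, hG]
    cases b
    · simp only [flag_false, List.head?_nil]
      rw [eval_emitTT S hR (by rw [hT]; exact hx), hT]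
      rfl
    · simp [eval, leafEdges, encPairs]
  · simp only [emitLeaf, eval, hY, head?_stateKey_some]
    rw [eval_emit S (by decide) (by decide) (by decide) (by decide) hR (by rw [hT]; exact hx)
      (by rw [hY]; exact hy)]
    simp only [ne_eq, reduceCtorEq, not_false_eq_true, Function.update_of_ne, hG]
    cases b
    · simp [eval, leafEdges, hT, hY]
    · simp only [flag_true, List.head?_cons, emitSrc, eval]
      rw [eval_copy (a := .Y) (b := .E) _ (by decide) (by decide) (by decide) (by simp [hR])
        (by simpa [hY] using hy)]
      simp [hY, hT, leafEdges, encPairs, encPair]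

end Cmd

/-! ### Reading productions, and the length of their edge lists -/

namespace Cmd

open InputSymbol

variable {A : RankedAlphabet} {N : ℕ} (S : Reg → List (Tok A))

/-- A crude bound that suffices, because child `i` is preceded by `i` siblings with nonempty codes.
-/
theorem length_encodeNat_le (i : ℕ) : (Computability.encodeNat i).length ≤ i := by
  have pos (p : PosNum) : (Computability.encodePosNum p).length ≤ (p : ℕ) := by
    induction p with
    | one => simp [Computability.encodePosNum]
    | bit0 p ih =>
      have : 0 < (p : ℕ) := PosNum.cast_pos p
      simp only [Computability.encodePosNum, List.length_cons, PosNum.cast_bit0]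
      omega
    | bit1 p ih =>
      simp only [Computability.encodePosNum, List.length_cons, PosNum.cast_bit1]
      omega
  have num (k : Num) : (Computability.encodeNum k).length ≤ (k : ℕ) := by
    cases k with
    | zero => simp [Computability.encodeNum]
    | pos p => exact pos p
  simpa [Computability.encodeNat] using num (i : Num)

theorem one_le_length_codeTree {n : ℕ} (t : RTree A (Option (Fin n))) :
    1 ≤ (codeTree t : List (InputSymbol A)).length := by
  cases t with
  | leaf q => rcases q with _ | i <;> simp [codeTree, codeState, codeNat]
  | node s ts => simp [codeTree]

theorem length_codeTree_node {n : ℕ} (s : A.Sym) (ts : Fin (A.rank s) → RTree A (Option (Fin n))) :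
    (codeTree (.node s ts)).length = 1 + ∑ i, (codeTree (ts i)).length := by
  rw [codeTree, List.length_cons, List.length_flatten, List.map_ofFn, List.sum_ofFn, add_comm]
  rfl

/-- The symbol at the node takes one entry, and each of the `i` earlier siblings at least one. -/
theorem length_codeTree_child {n : ℕ} (s : A.Sym)
    (ts : Fin (A.rank s) → RTree A (Option (Fin n))) (i : Fin (A.rank s)) :
    1 + i.val + (codeTree (ts i)).length ≤ (codeTree (.node s ts)).length := by
  rw [length_codeTree_node, ← Finset.sum_erase_add _ _ (Finset.mem_univ i), add_assoc]
  have h1 : (Finset.Iio i).card ≤ ∑ j ∈ Finset.univ.erase i, (codeTree (ts j)).length := by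
    rw [Finset.card_eq_sum_ones]
    refine (Finset.sum_le_sum fun j _ => one_le_length_codeTree (ts j)).trans
      (Finset.sum_le_sum_of_subset fun j hj => ?_)
    simpa using (Finset.mem_Iio.1 hj).ne
  rw [Fin.card_Iio] at h1
  omega

theorem length_leaves_le {n : ℕ} (t : RTree A (Option (Fin n))) (w : Pos) :
    (leaves t w).length ≤ (codeTree t).length := by
  induction t generalizing w with
  | leaf q => exact one_le_length_codeTree _
  | node s ts ih =>
    rw [length_codeTree_node, leaves, List.length_flatten, List.map_ofFn, List.sum_ofFn]
    exact (Finset.sum_le_sum fun i _ => ih i _).trans (Nat.le_add_left ..)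

theorem length_posKey_append (w : Pos) (i : ℕ) :
    (posKey (w ++ [i]) : List (Tok A)).length ≤ (posKey w : List (Tok A)).length + (2 + i) := by
  have := length_encodeNat_le i
  simp [posKey, codeNat]
  omega

/-- Descending to child `i` lengthens the position key by at most `2 + i` and shortens the code by
at least `1 + i`, whence the factor 2. -/
theorem length_of_mem_leaves {n : ℕ} (t : RTree A (Option (Fin n))) (w : Pos)
    {z : Option (Fin n) × Pos} (hz : z ∈ leaves t w) :
    (stateKey z.1 : List (Tok A)).length ≤ (codeTree t).length ∧
      (posKey z.2 : List (Tok A)).length ≤ (posKey w : List (Tok A)).length + 2 * (codeTree t).length := by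
  induction t generalizing w with
  | leaf q =>
    rw [leaves, List.mem_singleton] at hz
    subst hz
    simp [stateKey, codeTree]
  | node s ts ih =>
    rw [leaves, List.mem_flatten] at hz
    obtain ⟨l, hl, hz⟩ := hz
    obtain ⟨i, rfl⟩ := List.mem_ofFn.1 hl
    have h := ih i _ hz
    have h1 := length_codeTree_child s ts i
    have h2 := length_posKey_append (A := A) w i
    omega

/-- Reads a production, and adds its edges to `E`. -/
noncomputable def readProd : Cmd Reg (Tok A) :=
  readTree ;; readState .T ;; readNum .X ;; clear .X ;; readConstrs ;; forPairs emitLeaf ;;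
    clear .T ;; clear .C

/-- The code of a production. -/
def codeProd {n : ℕ} (t : RTree A (Option (Fin n))) (q : Option (Fin n)) (m : ℕ)
    (es : List (Pos × Pos)) : List (InputSymbol A) :=
  codeTree t ++ codeState q ++ codeNat m ++ codeList codeConstr es

open Classical in
/-- The edges for a production. -/
noncomputable def prodEdges {n : ℕ} (t : RTree A (Option (Fin n))) (q : Option (Fin n))
    (es : List (Pos × Pos)) : List (List (Tok A) × List (Tok A)) :=
  (leaves t []).flatMap fun z => leafEdges q z.1 (decide (∃ c ∈ es, c.1 ≠ c.2 ∧ c.1 = z.2))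

theorem exists_constrPairs (es : List (Pos × Pos)) (w : Pos) :
    (∃ c ∈ es.reverse.flatMap constrPairs, c.1 = (posKey w : List (Tok A))) ↔
      ∃ c ∈ es, c.1 ≠ c.2 ∧ c.1 = w := by
  simp only [List.mem_flatMap, List.mem_reverse, constrPairs]
  constructor
  · rintro ⟨c, ⟨e, he, hc⟩, h⟩
    split_ifs at hc with h'
    · simp at hc
    · rw [List.mem_singleton] at hc
      subst hc
      exact ⟨e, he, h', posKey_injective h⟩
  · rintro ⟨e, he, h, rfl⟩
    exact ⟨_, ⟨e, he, by rw [if_neg h]; exact List.mem_singleton_self _⟩, rfl⟩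

theorem eval_readProd {n : ℕ} {t : RTree A (Option (Fin n))} {q : Option (Fin n)} {m : ℕ}
    {es : List (Pos × Pos)} {rest : List (Tok A)} {e : List (List (Tok A) × List (Tok A))}
    (hI : S .I = toks (codeProd t q m es) ++ rest) (hE : S .E = encPairs e) (hS : Clean S)
    (hl : 2 * (codeProd t q m es).length ≤ bound N) :
    eval N readProd S = Function.update (Function.update S .I rest) .E
      (encPairs (prodEdges t q es ++ e)) := by
  classical
  have hS' : ∀ k, k ≠ .E → k ≠ .I → S k = [] := hS
  have h1 := one_le_length_codeTree t
  simp only [codeProd, List.length_append] at hl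
  have hq : (stateKey q : List (Tok A)).length = (codeState q : List (InputSymbol A)).length := by
    simp [stateKey]
  have hes := length_encPairs_constrs (A := A) es
  -- The result function of `eval_forPairs` receives strings; the inverse of `stateKey` recovers the
  -- state.
  have inv : ∀ y : Option (Fin n), Function.invFun stateKey (stateKey y : List (Tok A)) = y :=
    Function.leftInverse_invFun stateKey_injective
  simp only [readProd, eval]
  rw [eval_readTree (t := t)
      (rest := toks (codeState q ++ codeNat m ++ codeList codeConstr es) ++ rest) _
      (by simp [hS']) (by simp [hI, codeProd]) (by simp [hS']) (by omega),
    eval_readState (k := .T) (q := q) (rest := toks (codeNat m ++ codeList codeConstr es) ++ rest) _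
      (by decide) (by simp) (by omega),
    eval_readNum (k := .X) (m := m) (rest := toks (codeList codeConstr es) ++ rest) _
      (by decide) (by simp) (by omega),
    eval_clear (a := .X) _ (by simp [hS']; omega),
    eval_readConstrs (es := es) (rest := rest) _ (by simp) (by simp) (by simp [hS']) (by simp [hS'])
      (by simp [hS']) (by simp [hS']) (by simp [hS']) (by simp [hS']) (by omega),
    eval_forPairs (l := (leaves t []).reverse.map leafPair) (c := es.reverse.flatMap constrPairs)
      (e := e) _ (fun y _ b => leafEdges q (Function.invFun stateKey y) b)
      (by
        intro p hp
        obtain ⟨z, -, rfl⟩ := List.mem_map.1 hp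
        exact ⟨sepFree_stateKey _, sepFree_posKey _⟩)
      (by
        intro p hp
        obtain ⟨c, -, hp⟩ := List.mem_flatMap.1 hp
        unfold constrPairs at hp
        split_ifs at hp
        · simp at hp
        · rw [List.mem_singleton] at hp
          subst hp
          exact ⟨sepFree_posKey _, by simp [SepFree]⟩)
      (by simp [hS']) (by simp) (by simpa using hE) (by simp) (by simp [hS']) (by simp [hS'])
      (by simp [hS']) (by simp [hS']) (by simp [hS']) (by omega)
      (by
        have := length_leaves_le t []
        simp only [List.length_map, List.length_reverse]
        omega)
      (by
        intro p hp
        obtain ⟨z, hz, rfl⟩ := List.mem_map.1 hp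
        have := length_of_mem_leaves t [] (List.mem_reverse.1 hz)
        simp only [leafPair]
        simp only [posKey, List.flatMap_nil, toks_nil, List.reverse_nil, List.length_nil] at this
        simp only [posKey]
        omega)
      (by omega)
      (by
        intro S' p b hp hY hX hG hR hT
        obtain ⟨z, hz, rfl⟩ := List.mem_map.1 hp
        have := length_of_mem_leaves t [] (List.mem_reverse.1 hz)
        simp only [leafPair, inv] at hY ⊢
        exact eval_emitLeaf S' hY (by simp [hT, hS']) hG hR (by omega) (by omega)),
    eval_clear (a := .T) _ (by simp [hS']; omega),
    eval_clear (a := .C) _ (by simp; omega)]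
  have : ((leaves t []).reverse.map leafPair).reverse.flatMap
      (fun p : List (Tok A) × List (Tok A) => leafEdges q (Function.invFun stateKey p.1)
        (decide (∃ c ∈ es.reverse.flatMap constrPairs, c.1 = p.2)))
      = (prodEdges t q es : List (List (Tok A) × List (Tok A))) := by
    rw [List.map_reverse, List.reverse_reverse, prodEdges, List.flatMap_map]
    simp only [leafPair, inv, exists_constrPairs]
  rw [this]
  funext j
  cases j <;> simp [hS']

/-- The worst case is a constrained proper leaf: two edges with three state keys, the source symbol
and four separators. -/
theorem length_encPairs_leafEdges {n M : ℕ} {x y : Option (Fin n)} (b : Bool)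
    (hx : (stateKey x : List (Tok A)).length ≤ M) (hy : (stateKey y : List (Tok A)).length ≤ M) :
    (encPairs (leafEdges x y b) : List (Tok A)).length ≤ 3 * M + 5 := by
  rcases y with _ | i <;> cases b <;> simp [leafEdges, encPairs, encPair] <;> omega

theorem length_encPairs_flatMap {α : Type} (f : α → List (List (Tok A) × List (Tok A)))
    (l : List α) {M : ℕ} (h : ∀ a ∈ l, (encPairs (f a)).length ≤ M) :
    (encPairs (l.flatMap f)).length ≤ l.length * M := by
  induction l with
  | nil => simp [encPairs]
  | cons a l ih =>
    rw [List.flatMap_cons, encPairs_append, List.length_append, List.length_cons, add_mul, one_mul,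
      add_comm]
    exact add_le_add (ih fun b hb => h b (List.mem_cons_of_mem _ hb)) (h a List.mem_cons_self)

theorem length_encPairs_prodEdges {n M : ℕ} {t : RTree A (Option (Fin n))} {q : Option (Fin n)}
    {m : ℕ} {es : List (Pos × Pos)} (hl : (codeProd t q m es).length ≤ M) :
    (encPairs (prodEdges t q es : List (List (Tok A) × List (Tok A)))).length
      ≤ (codeProd t q m es).length * (3 * M + 5) := by
  have hq : (stateKey q : List (Tok A)).length = (codeState q : List (InputSymbol A)).length := by
    simp [stateKey]
  have hc : (codeProd t q m es).length = (codeTree t).length + (codeState q : List (InputSymbol A)).length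
      + (codeNat m : List (InputSymbol A)).length
      + (codeList codeConstr es : List (InputSymbol A)).length := by
    simp only [codeProd, List.length_append]
  refine (length_encPairs_flatMap _ _ fun z hz => length_encPairs_leafEdges (M := M) _ ?_ ?_).trans
    (Nat.mul_le_mul_right _ ?_)
  · omega
  · have := (length_of_mem_leaves t [] hz).1
    omega
  · have := length_leaves_le t []
    omega

end Cmd

/-! ### The whole decision procedure -/

namespace Cmd

open InputSymbol

variable {A : RankedAlphabet} {N : ℕ} (S : Reg → List (Tok A))

/-- Skips one final weight. -/
def finalBody : Cmd Reg (Tok A) :=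
  case .I fun
    | some (.inp item) => pop .I ;; readNum .X ;; clear .X
    | _ => nop

/-- Skips the final weights. -/
def readFinals : Cmd Reg (Tok A) := rep finalBody ;; pop .I

theorem eval_readFinals {α : Type} {f : α → ℕ} {l : List α} {rest : List (Tok A)}
    (hI : S .I = toks (codeList (fun a => codeNat (f a)) l) ++ rest) (hX : S .X = [])
    (hl : (codeList (fun a => codeNat (f a)) l : List (InputSymbol A)).length ≤ bound N) :
    eval N readFinals S = Function.update S .I rest := by
  have := eval_rep_foldl (N := N) (c := finalBody)
    (fun (_ : Unit) (l : List α) =>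
      Function.update S .I (toks (codeList (fun a => codeNat (f a)) l) ++ rest))
    (fun _ _ => ()) l ()
    (by
      intro _ a l h
      have hlen := length_mem_codeList (fun a => (codeNat (f a) : List (InputSymbol A))) h
      simp only [finalBody, eval, Function.update_self, codeList_cons, toks_cons, toks_append,
        List.cons_append, List.head?_cons, List.tail_cons]
      rw [eval_readNum (k := .X) (m := f a)
          (rest := toks (codeList (fun a => codeNat (f a)) l) ++ rest) _ (by decide) (by simp)
          (by omega),
        eval_clear (a := .X) _ (by simp [hX]; omega)]
      funext j
      cases j <;> simp [hX])
    (by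
      intro _
      simp [finalBody, eval, codeList])
    ((length_le_codeList _ l).trans hl)
  rw [← hI, Function.update_eq_self] at this
  simp only [readFinals, eval]
  rw [this]
  simp [codeList]

/-- Reads one production of a list. -/
noncomputable def prodBody : Cmd Reg (Tok A) :=
  case .I fun
    | some (.inp item) => pop .I ;; readProd
    | _ => nop

/-- Reads the productions. -/
noncomputable def readProds : Cmd Reg (Tok A) := rep prodBody ;; pop .I

section prods

variable {α : Type} {n : ℕ} (t : α → RTree A (Option (Fin n))) (q : α → Option (Fin n)) (m : α → ℕ)
  (es : α → List (Pos × Pos))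

/-- The code of a list of productions. -/
def codeProds (ps : List α) : List (InputSymbol A) :=
  codeList (fun a => codeProd (t a) (q a) (m a) (es a)) ps

/-- The edges for a list of productions. -/
noncomputable def edges (ps : List α) : List (List (Tok A) × List (Tok A)) :=
  ps.reverse.flatMap fun a => prodEdges (t a) (q a) (es a)

theorem eval_readProds {ps : List α} {rest : List (Tok A)}
    (hI : S .I = toks (codeProds t q m es ps) ++ rest) (hE : S .E = []) (hS : Clean S)
    (hl : 2 * (codeProds t q m es ps).length ≤ bound N) :
    eval N readProds S = Function.update (Function.update S .I rest) .E
      (encPairs (edges t q es ps)) := by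
  have hS' : ∀ k, k ≠ .E → k ≠ .I → S k = [] := hS
  have := eval_rep_foldl (N := N) (c := prodBody)
    (fun e (l : List α) => Function.update (Function.update S
      .I (toks (codeProds t q m es l) ++ rest)) .E (encPairs e))
    (fun e a => prodEdges (t a) (q a) (es a) ++ e) ps []
    (by
      intro e a l h
      have hlen := length_mem_codeList (fun a => codeProd (t a) (q a) (m a) (es a)) h
      rw [← codeProds] at hlen
      simp only [prodBody, eval, ne_eq, reduceCtorEq, not_false_eq_true, Function.update_of_ne,
        Function.update_self, codeProds, codeList_cons, toks_cons, toks_append, List.cons_append,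
        List.head?_cons, List.tail_cons]
      rw [eval_readProd (t := t a) (q := q a) (m := m a) (es := es a) (e := e)
          (rest := toks (codeProds t q m es l) ++ rest) _ (by simp [codeProds]) (by simp)
          (fun k h1 h2 => by simp [h1, h2, hS']) (by omega)]
      funext j
      cases j <;> simp [codeProds])
    (by
      intro e
      simp [prodBody, eval, codeProds, codeList])
    ((length_le_codeList (fun a => codeProd (t a) (q a) (m a) (es a)) ps).trans
      (by rw [codeProds] at hl; omega))
  have e1 : Function.update (Function.update S .I (toks (codeProds t q m es ps) ++ rest))
      .E (encPairs []) = S := by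
    rw [← hI, Function.update_eq_self]
    funext j
    cases j <;> simp [hE, encPairs]
  rw [e1] at this
  have fold : ∀ (l : List α) (e : List (List (Tok A) × List (Tok A))),
      l.foldl (fun e a => prodEdges (t a) (q a) (es a) ++ e) e = edges t q es l ++ e := by
    intro l
    induction l with
    | nil => intro e; simp [edges]
    | cons a l ih => intro e; rw [List.foldl_cons, ih]; simp [edges]
  rw [fold, List.append_nil] at this
  simp only [readProds, eval]
  rw [this]
  funext j
  cases j <;> simp [codeProds, codeList]

theorem length_encPairs_edges (ps : List α) {M : ℕ} (hM : (codeProds t q m es ps).length ≤ M) :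
    (encPairs (edges t q es ps : List (List (Tok A) × List (Tok A)))).length
      ≤ (codeProds t q m es ps).length * (3 * M + 5) := by
  induction ps with
  | nil => simp [edges, encPairs]
  | cons a l ih =>
    simp only [codeProds, codeList_cons, List.length_cons, List.length_append] at hM ih ⊢
    have h := length_encPairs_prodEdges (t := t a) (q := q a) (m := m a) (es := es a) (M := M)
      (by omega)
    have ih := ih (by omega)
    simp only [edges, List.reverse_cons, List.flatMap_append, encPairs_append, List.length_append,
      List.flatMap_cons, List.flatMap_nil, List.append_nil] at ih ⊢
    rw [add_mul, add_mul]
    omega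

theorem pairsFree_edges (ps : List α) :
    PairsFree (edges t q es ps : List (List (Tok A) × List (Tok A))) := by
  classical
  intro p hp
  obtain ⟨a, -, hp⟩ := List.mem_flatMap.1 hp
  obtain ⟨⟨y, w⟩, -, hp⟩ := List.mem_flatMap.1 hp
  have h := sepFree_stateKey (A := A) (n := n)
  have hs := sepFree_src (A := A)
  dsimp only at hp
  generalize decide (∃ c ∈ es a, c.1 ≠ c.2 ∧ c.1 = w) = b at hp
  rcases y with _ | i <;> cases b <;> simp only [leafEdges, List.mem_cons, List.not_mem_nil,
    or_false] at hp
  · subst hp; exact ⟨h _, h _⟩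
  · subst hp; exact ⟨h _, h _⟩
  · rcases hp with rfl | rfl
    · exact ⟨hs, h _⟩
    · exact ⟨h _, h _⟩

/-- The decision procedure. -/
noncomputable def decideDuplication : Cmd Reg (Tok A) :=
  move .W .I ;; readFinals ;; readProds ;; rep round ;; check

open Classical in
theorem eval_decideDuplication {β : Type} (f : β → ℕ) (l : List β) (hl : l ≠ []) (ps : List α)
    {c : List (InputSymbol A)} (hc : c = codeList (fun a => codeNat (f a)) l ++ codeProds t q m es ps) :
    eval c.length decideDuplication (Function.update (fun _ => []) Reg.W (toks c).reverse)
      = Function.update (fun _ => []) Reg.G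
        (flag (decide (∃ p ∈ keepEdges^[bound c.length] (edges t q es ps), p.1 = [.src]))) := by
  have hlen : c.length = (codeList (fun a => codeNat (f a)) l : List (InputSymbol A)).length
      + (codeProds t q m es ps).length := by rw [hc, List.length_append]
  -- A nonempty list of final weights needs an announcement, the end of a number and the end of the
  -- list.
  have h3 : 3 ≤ c.length := by
    obtain ⟨b, l, rfl⟩ := List.exists_cons_of_ne_nil hl
    rw [hlen, codeList_cons]
    simp [codeNat, codeProds, codeList]
    omega
  generalize c.length = N at hlen h3
  -- The edge list has at most quadratic length, and the fourth power in `bound` dominates that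
  -- bound from length 3 on.
  have hb : N * (3 * N + 5) ≤ bound N := by
    have h9 : 3 * N + 5 ≤ N * N * N := by nlinarith [Nat.mul_le_mul h3 h3]
    calc N * (3 * N + 5) ≤ N * (N * N * N) := Nat.mul_le_mul_left _ h9
      _ = bound N := by rw [bound]; ring
  have hb2 : 2 * N ≤ bound N := le_trans (by nlinarith) hb
  have hed : (encPairs (edges t q es ps : List (List (Tok A) × List (Tok A)))).length ≤ bound N :=
    ((length_encPairs_edges t q m es ps (M := N) (by omega)).trans
      (Nat.mul_le_mul_right _ (by omega))).trans hb
  have hf := pairsFree_edges (A := A) t q es ps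
  have hk : ∀ k, PairsFree (keepEdges^[k] (edges t q es ps) : List (List (Tok A) × List (Tok A))) ∧
      (encPairs (keepEdges^[k] (edges t q es ps) : List (List (Tok A) × List (Tok A)))).length
        ≤ bound N := by
    intro k
    induction k with
    | zero => exact ⟨hf, hed⟩
    | succ k ih =>
      rw [Function.iterate_succ_apply']
      exact ⟨fun p hp => ih.1 p (mem_keepEdges.1 hp).1, (length_encPairs_keepEdges _).trans ih.2⟩
  simp only [decideDuplication, eval]
  rw [eval_move (a := .W) (b := .I) _ (by decide) (by simp [hc]; omega),
    eval_readFinals (f := f) (l := l) (rest := toks (codeProds t q m es ps)) _ (by simp [hc])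
      (by simp) (by omega),
    eval_readProds (t := t) (q := q) (m := m) (es := es) (ps := ps) (rest := []) _ (by simp)
      (by simp) (by intro k _ _; cases k <;> simp_all) (by omega),
    eval_rep, eval_rounds (l := edges t q es ps) _ _ hf (by simp)
      (by intro k _ _; cases k <;> simp_all) hed (by omega),
    eval_check (l := keepEdges^[bound N] (edges t q es ps)) _ (hk _).1 (by simp)
      (by intro k _ _; cases k <;> simp_all) (hk _).2 (by omega)]
  funext j
  cases j <;> simp

end prods

end Cmd

/-! ### The order on positions -/

namespace Pos

theorem Before.trans {u v w : Pos} (h : Before u v) (h' : Before v w) : Before u w := by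
  induction u generalizing v w with
  | nil => exact h.elim
  | cons i u ih => cases v with
    | nil => exact h'.elim
    | cons j v => cases w with
      | nil => trivial
      | cons k w =>
        rcases h with h | ⟨rfl, h⟩ <;> rcases h' with h' | ⟨rfl, h'⟩
        · exact .inl (h.trans h')
        · exact .inl h
        · exact .inl h'
        · exact .inr ⟨rfl, ih h h'⟩

theorem before_total (v w : Pos) : v = w ∨ Before v w ∨ Before w v := by
  induction v generalizing w with
  | nil => cases w with
    | nil => exact .inl rfl
    | cons j w => exact .inr (.inr trivial)
  | cons i v ih => cases w with
    | nil => exact .inr (.inl trivial)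
    | cons j w =>
      rcases lt_trichotomy i j with h | rfl | h
      · exact .inr (.inl (.inl h))
      · rcases ih w with rfl | h | h
        · exact .inl rfl
        · exact .inr (.inl (.inr ⟨rfl, h⟩))
        · exact .inr (.inr (.inr ⟨rfl, h⟩))
      · exact .inr (.inr (.inl h))

theorem exists_least (s : Finset Pos) (hs : s.Nonempty) :
    ∃ w ∈ s, ∀ x ∈ s, x = w ∨ Before w x := by
  induction hs using Finset.Nonempty.cons_induction with
  | singleton w => exact ⟨w, by simp, by simp⟩
  | cons a s ha hs ih =>
    obtain ⟨w, hw, h⟩ := ih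
    rcases before_total a w with rfl | haw | hwa
    · exact absurd hw ha
    · refine ⟨a, by simp, fun x hx => ?_⟩
      rcases Finset.mem_cons.1 hx with rfl | hx
      · exact .inl rfl
      · rcases h x hx with rfl | hx
        · exact .inr haw
        · exact .inr (haw.trans hx)
    · refine ⟨w, by simp [hw], fun x hx => ?_⟩
      rcases Finset.mem_cons.1 hx with rfl | hx
      · exact .inr hwa
      · exact h x hx

end Pos

/-! ### Subtrees, replacement and filling of leaves -/

namespace RTree

variable {A : RankedAlphabet} {Z : Type}

theorem subtreeAt_node (s : A.Sym) (ts : Fin (A.rank s) → RTree A Z) (i : Fin (A.rank s)) (w : Pos) :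
    (node s ts).subtreeAt (i.val :: w) = (ts i).subtreeAt w := by
  simp [subtreeAt]

theorem subtreeAt_nil (t : RTree A Z) : t.subtreeAt [] = some t := by
  cases t <;> rfl

theorem replaceAt_nil (t t' : RTree A Z) : t.replaceAt [] t' = t' := by
  cases t <;> rfl

theorem exists_of_subtreeAt_node {s : A.Sym} {ts : Fin (A.rank s) → RTree A Z} {j : ℕ} {w : Pos}
    {t : RTree A Z} (h : (node s ts).subtreeAt (j :: w) = some t) :
    ∃ i : Fin (A.rank s), i.val = j ∧ (ts i).subtreeAt w = some t := by
  by_cases hj : j < A.rank s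
  · exact ⟨⟨j, hj⟩, rfl, by rwa [← subtreeAt_node s ts ⟨j, hj⟩ w]⟩
  · simp [subtreeAt, hj] at h

theorem replaceAt_node (s : A.Sym) (ts : Fin (A.rank s) → RTree A Z)
    (i : Fin (A.rank s)) (w : Pos) (t : RTree A Z) :
    (node s ts).replaceAt (i.val :: w) t
      = node s (Function.update ts i ((ts i).replaceAt w t)) := by
  rw [replaceAt]
  congr 1
  funext j
  by_cases h : j = i
  · subst h; simp
  · simp [h, Fin.val_inj]

theorem height_add_length_le {t u : RTree A Z} {w : Pos} (h : t.subtreeAt w = some u) :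
    u.height + w.length ≤ t.height := by
  induction w generalizing t with
  | nil =>
    rw [subtreeAt_nil, Option.some.injEq] at h
    simp [h]
  | cons j w ih => cases t with
    | leaf z => simp [subtreeAt] at h
    | node s ts =>
      obtain ⟨i, rfl, hi⟩ := exists_of_subtreeAt_node h
      have := ih hi
      have := Finset.le_sup (f := fun i => (ts i).height + 1) (Finset.mem_univ i)
      rw [height, List.length_cons]
      omega

/-- Replaces the leaves of a tree by the trees that are given for their positions. -/
def fill : RTree A Z → (Pos → GTree A) → GTree A
  | leaf _, τ => τ []
  | node s ts, τ => node s fun i => (ts i).fill fun w => τ (i.val :: w)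

theorem subtreeAt_fill {t : RTree A Z} {τ : Pos → GTree A} {w : Pos} {z : Z}
    (h : t.subtreeAt w = some (leaf z)) : (t.fill τ).subtreeAt w = some (τ w) := by
  induction w generalizing t τ with
  | nil =>
    rw [subtreeAt_nil, Option.some.injEq] at h
    rw [h, subtreeAt_nil, fill]
  | cons j w ih => cases t with
    | leaf z => simp [subtreeAt] at h
    | node s ts =>
      obtain ⟨i, rfl, hi⟩ := exists_of_subtreeAt_node h
      rw [fill, subtreeAt_node, ih hi]

end RTree

/-! ### Derivations without regard to the order of steps -/

namespace WTGc

open RTree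

variable {A : RankedAlphabet} {Q : Type} {G : WTGc A Q}

/-- `G.Match ξ t`: there is a derivation from the tree `t` to the sentential form `ξ`. -/
inductive Match (G : WTGc A Q) : RTree A Q → GTree A → Prop
  | node (s : A.Sym) (ts : Fin (A.rank s) → RTree A Q) (us : Fin (A.rank s) → GTree A)
      (h : ∀ i, Match G (ts i) (us i)) : Match G (.node s ts) (.node s us)
  | leaf (p : Production A Q) (t : GTree A) (hp : p ∈ G.prods) (h : Match G p.lhs t)
      (hc : ∀ c ∈ p.constr, t.Satisfies c) : Match G (.leaf p.target) t

theorem match_ofGround (t : GTree A) : G.Match (ofGround t) t := by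
  induction t with
  | leaf z => exact z.elim
  | node s ts ih => exact .node _ _ _ ih

/-- Disjoint subtrees are matched independently, so a part of the form may be exchanged for anything
that matches the same subtree of `t`. -/
theorem Match.subtreeAt {ξ ξ' : RTree A Q} {t : GTree A} {w : Pos} (h : G.Match ξ t)
    (hw : ξ.subtreeAt w = some ξ') :
    ∃ s, t.subtreeAt w = some s ∧ G.Match ξ' s ∧
      ∀ ζ, G.Match ζ s → G.Match (ξ.replaceAt w ζ) t := by
  classical
  induction w generalizing ξ t with
  | nil =>
    rw [subtreeAt_nil, Option.some.injEq] at hw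
    subst hw
    exact ⟨t, subtreeAt_nil t, h, fun ζ hζ => by rwa [replaceAt_nil]⟩
  | cons j w ih => cases ξ with
    | leaf z => simp [RTree.subtreeAt] at hw
    | node s ts =>
      obtain ⟨i, rfl, hi⟩ := exists_of_subtreeAt_node hw
      cases h with
      | node _ _ us h =>
        obtain ⟨u, hu, hm, hr⟩ := ih (h i) hi
        refine ⟨u, by rwa [subtreeAt_node], hm, fun ζ hζ => ?_⟩
        rw [replaceAt_node]
        refine .node _ _ _ fun k => ?_
        by_cases hk : k = i
        · subst hk
          simpa using hr ζ hζ
        · simpa [hk] using h k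

theorem Match.step {p : {p // p ∈ G.prods}} {w : Pos} {ξ ζ : RTree A Q} {t : GTree A}
    (h : G.Match ξ t) (hs : G.Step t p w ξ ζ) :
    G.Match ζ t ∧ ∃ s, G.Match p.1.lhs s ∧ ∀ c ∈ p.1.constr, s.Satisfies c := by
  obtain ⟨hw, rfl, s, hs, hc⟩ := hs
  obtain ⟨s', hs', hm, hr⟩ := h.subtreeAt hw
  obtain rfl : s' = s := by simpa [hs] using hs'.symm
  exact ⟨hr _ (.leaf p.1 s' p.2 hm hc), s', hm, hc⟩

theorem Match.steps {d : List ({p // p ∈ G.prods} × Pos)} {ξ ζ : RTree A Q} {t : GTree A}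
    (hs : G.Steps t d ξ ζ) (h : G.Match ξ t) :
    G.Match ζ t ∧ ∀ p ∈ d.map Prod.fst, ∃ s, G.Match p.1.lhs s ∧ ∀ c ∈ p.1.constr, s.Satisfies c := by
  induction hs with
  | nil => exact ⟨h, by simp⟩
  | cons hst _ ih =>
    obtain ⟨h1, h2⟩ := h.step hst
    refine ⟨(ih h1).1, fun p hp => ?_⟩
    rcases List.mem_cons.1 hp with rfl | hp
    · exact h2
    · exact (ih h1).2 p hp

theorem Useful.exists_match {p : {p // p ∈ G.prods}} (h : G.Useful p) :
    ∃ s, G.Match p.1.lhs s ∧ ∀ c ∈ p.1.constr, s.Satisfies c := by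
  obtain ⟨t, q, d, hd, -, hp⟩ := h
  exact ((match_ofGround t).steps hd.1).2 p hp

theorem Steps.append {t : GTree A} {d d' : List ({p // p ∈ G.prods} × Pos)} {ξ ζ η : RTree A Q}
    (h : G.Steps t d ξ ζ) (h' : G.Steps t d' ζ η) : G.Steps t (d ++ d') ξ η := by
  induction h with
  | nil => exact h'
  | cons hs _ ih => exact .cons hs (ih h')

theorem Steps.lift {s : A.Sym} {us : Fin (A.rank s) → GTree A}
    {i : Fin (A.rank s)} {d : List ({p // p ∈ G.prods} × Pos)} {ξ ζ : RTree A Q}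
    (h : G.Steps (us i) d ξ ζ) (f : Fin (A.rank s) → RTree A Q) :
    G.Steps (.node s us) (d.map fun x => (x.1, i.val :: x.2)) (.node s (Function.update f i ξ))
      (.node s (Function.update f i ζ)) := by
  induction h with
  | nil => exact .nil _
  | cons hs _ ih =>
    obtain ⟨hw, rfl, u, hu, hc⟩ := hs
    refine .cons ⟨?_, ?_, u, ?_, hc⟩ ih
    · rw [subtreeAt_node, Function.update_self, hw]
    · rw [replaceAt_node, Function.update_self, Function.update_idem]
    · rw [subtreeAt_node, hu]

/-- Process the children from left to right and then the root, which is last since prefixes are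
larger. The third clause keeps the order strict: before the production at the root is applied, no
step has taken place there. -/
theorem Match.exists_steps {ξ : RTree A Q} {t : GTree A} (h : G.Match ξ t) :
    ∃ d, G.Steps t d (ofGround t) ξ ∧ (d.map Prod.snd).Pairwise Pos.Before ∧
      ((∀ q, ξ ≠ .leaf q) → ∀ w ∈ d.map Prod.snd, w ≠ []) := by
  classical
  induction h with
  | leaf p t hp _ hc ih =>
    obtain ⟨d, hd, hs, hn⟩ := ih
    refine ⟨d ++ [(⟨p, hp⟩, [])], hd.append (.cons ⟨subtreeAt_nil _, (replaceAt_nil _ _).symm, t,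
      subtreeAt_nil _, hc⟩ (.nil _)), ?_, fun h => absurd rfl (h p.target)⟩
    rw [List.map_append, List.pairwise_append]
    refine ⟨hs, by simp, fun w hw x hx => ?_⟩
    obtain rfl : x = [] := by simpa using hx
    have := hn p.lhs_not_state w hw
    cases w with
    | nil => exact absurd rfl this
    | cons i w => trivial
  | node s ts us _ ih =>
    choose d hd hs _ using ih
    -- The stage at which the first `j` children are finished. All positions used so far start with
    -- a number below `j` and thus precede those in child `j`.
    have key : ∀ j ≤ A.rank s, ∃ e, G.Steps (.node s us) e (ofGround (.node s us))
        (.node s fun i => if i.val < j then ts i else ofGround (us i)) ∧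
        (e.map Prod.snd).Pairwise Pos.Before ∧ ∀ w ∈ e.map Prod.snd, ∃ i < j, ∃ v, w = i :: v := by
      intro j
      induction j with
      | zero => exact fun _ => ⟨[], by simpa [ofGround] using Steps.nil _, by simp, by simp⟩
      | succ j ih =>
        intro hj
        obtain ⟨e, he, hes, hep⟩ := ih (by omega)
        have hl := (hd ⟨j, hj⟩).lift (s := s) (us := us)
          (fun i => if i.val < j then ts i else ofGround (us i))
        refine ⟨e ++ (d ⟨j, hj⟩).map (fun x => (x.1, j :: x.2)), he.append ?_, ?_, ?_⟩
        · convert hl using 2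
          · funext i
            by_cases hi : i = ⟨j, hj⟩
            · subst hi; simp
            · simp [hi]
          · funext i
            by_cases hi : i = ⟨j, hj⟩
            · subst hi; simp
            · have : i.val ≠ j := fun h => hi (Fin.ext h)
              have : i.val < j + 1 ↔ i.val < j := by omega
              simp only [ne_eq, hi, not_false_eq_true, Function.update_of_ne, this]
        · rw [List.map_append, List.pairwise_append]
          refine ⟨hes, ?_, ?_⟩
          · rw [List.map_map, List.pairwise_map]
            exact (List.pairwise_map.1 (hs ⟨j, hj⟩)).imp fun h => .inr ⟨rfl, h⟩
          · intro w hw x hx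
            obtain ⟨i, hi, v, rfl⟩ := hep w hw
            obtain ⟨y, hy, rfl⟩ := List.mem_map.1 hx
            obtain ⟨z, -, rfl⟩ := List.mem_map.1 hy
            exact .inl hi
        · intro w hw
          rw [List.map_append, List.mem_append] at hw
          rcases hw with hw | hw
          · obtain ⟨i, hi, v, rfl⟩ := hep w hw
            exact ⟨i, by omega, v, rfl⟩
          · obtain ⟨y, hy, rfl⟩ := List.mem_map.1 hw
            obtain ⟨z, -, rfl⟩ := List.mem_map.1 hy
            exact ⟨j, by omega, _, rfl⟩
    obtain ⟨e, he, hes, hep⟩ := key _ le_rfl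
    refine ⟨e, by simpa using he, hes, fun _ w hw => ?_⟩
    obtain ⟨i, -, v, rfl⟩ := hep w hw
    simp

/-- From here on derivability is the inductive relation `Match`, and left-most sequences of steps
can be forgotten. -/
theorem derivations_nonempty_iff {q : Q} {t : GTree A} :
    (G.derivations q t).Nonempty ↔ G.Match (.leaf q) t := by
  constructor
  · rintro ⟨d, hd, -⟩
    exact ((match_ofGround t).steps hd).1
  · intro h
    obtain ⟨d, hd, hs, -⟩ := h.exists_steps
    exact ⟨d, hd, hs⟩

theorem match_fill {ξ : RTree A Q} {τ : Pos → GTree A}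
    (h : ∀ w z, ξ.subtreeAt w = some (.leaf z) → G.Match (.leaf z) (τ w)) :
    G.Match ξ (ξ.fill τ) := by
  induction ξ generalizing τ with
  | leaf z => exact h [] z (subtreeAt_nil _)
  | node s ts ih =>
    exact .node _ _ _ fun i => ih i fun w z hw => h _ _ (by rwa [subtreeAt_node])

/-- A longest path of `t` spends at most `ξ.height` steps inside `ξ` and the rest below one of its
leaves. -/
theorem Match.exists_high_leaf {ξ : RTree A Q} {t : GTree A} {m : ℕ} (h : G.Match ξ t)
    (ht : ξ.height + m < t.height) :
    ∃ w z s, ξ.subtreeAt w = some (.leaf z) ∧ t.subtreeAt w = some s ∧ G.Match (.leaf z) s ∧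
      m < s.height := by
  induction ξ generalizing t with
  | leaf z => exact ⟨[], z, t, subtreeAt_nil _, subtreeAt_nil _, h, by omega⟩
  | node s ts ih =>
    cases h with
    | node _ _ us h =>
      rw [height, height, Finset.lt_sup_iff] at ht
      obtain ⟨i, -, hi⟩ := ht
      have := Finset.le_sup (f := fun i => (ts i).height + 1) (Finset.mem_univ i)
      obtain ⟨w, z, u, hw, hu, hm, hlt⟩ := ih i (h i) (by omega)
      exact ⟨i.val :: w, z, u, by rwa [subtreeAt_node], by rwa [subtreeAt_node], hm, hlt⟩

end WTGc

/-! ### Walks of prescribed length in a finite graph -/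

/-- There is a walk of length `k` from `x` along the relation `r`. -/
def Walk {α : Type} (r : α → α → Prop) : ℕ → α → Prop
  | 0, _ => True
  | k + 1, x => ∃ y, r x y ∧ Walk r k y

namespace Walk

variable {α : Type} {r : α → α → Prop}

theorem of_succ {k : ℕ} {x : α} (h : Walk r (k + 1) x) : Walk r k x := by
  induction k generalizing x with
  | zero => trivial
  | succ k ih =>
    obtain ⟨y, hy, h⟩ := h
    exact ⟨y, hy, ih h⟩

theorem of_le {k m : ℕ} (hkm : k ≤ m) {x : α} (h : Walk r m x) : Walk r k x := by
  induction hkm with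
  | refl => exact h
  | step _ ih => exact ih h.of_succ

theorem of_loop {x : α} (h : r x x) (k : ℕ) : Walk r k x := by
  induction k with
  | zero => trivial
  | succ k ih => exact ⟨x, h, ih⟩

/-- The sets `V k` of points of `s` that start a walk of length `k` decrease, and two consecutive
equal sets stay equal forever. Within `s.card` steps they become constant or empty, and `x ∈ V k`
excludes the latter. No cycle has to be exhibited. -/
theorem of_card_le {s : Finset α} (hs : ∀ x ∈ s, ∀ y, r x y → y ∈ s) {k : ℕ} (hk : s.card ≤ k)
    {x : α} (hx : x ∈ s) (h : Walk r k x) (m : ℕ) : Walk r m x := by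
  classical
  set V : ℕ → Finset α := fun k => s.filter (Walk r k)
  have hV : ∀ k, V (k + 1) ⊆ V k := fun k y hy => by
    simp only [V, Finset.mem_filter] at hy ⊢
    exact ⟨hy.1, hy.2.of_succ⟩
  have hstable : ∀ k, V (k + 1) = V k → V (k + 2) = V (k + 1) := fun k e => by
    refine (hV _).antisymm fun y hy => ?_
    simp only [V, Finset.mem_filter] at hy ⊢
    obtain ⟨hy, z, hz, h⟩ := hy
    have : z ∈ V k := by simp [V, h, hs y hy z hz]
    rw [← e] at this
    exact ⟨hy, z, hz, (Finset.mem_filter.1 this).2⟩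
  -- As long as the sets have not become constant, each round has removed at least one point.
  have hcard : ∀ k, V (k + 1) = V k ∨ (V k).card + k ≤ s.card := by
    intro k
    induction k with
    | zero => exact .inr (by simpa using Finset.card_filter_le _ _)
    | succ k ih =>
      rcases ih with e | ih
      · exact .inl (hstable k e)
      · by_cases e : V (k + 1) = V k
        · exact .inl (hstable k e)
        · have := Finset.card_lt_card (Finset.ssubset_iff_subset_ne.2 ⟨hV k, e⟩)
          exact .inr (by omega)
  have hxk : x ∈ V k := by simp [V, hx, h]
  have e : V (k + 1) = V k := by
    rcases hcard k with e | e
    · exact e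
    · have := Finset.card_pos.2 ⟨x, hxk⟩
      omega
  have : ∀ j, V (k + j + 1) = V (k + j) ∧ x ∈ V (k + j) := by
    intro j
    induction j with
    | zero => exact ⟨e, hxk⟩
    | succ j ih => exact ⟨hstable _ ih.1, by rw [← add_assoc, ih.1]; exact ih.2⟩
  exact ((Finset.mem_filter.1 (this m).2).2).of_le (Nat.le_add_left ..)

end Walk

/-! ### The graph of states and the large duplication property -/

namespace WTGh

open RTree

variable {A : RankedAlphabet} {G : WTGh A}

/-- The position `w` is related to another position by a constraint of `p`. -/
def Constrained {Q : Type} (p : Production A Q) (w : Pos) : Prop :=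
  ∃ c ∈ p.constr, c.1 ≠ c.2 ∧ c.1 = w

/-- Derivations that lead to the state `x` may continue at the state `y`. -/
def Edge (G : WTGh A) (x y : Option (Fin G.n)) : Prop :=
  ∃ p ∈ G.toWTGc.prods, p.target = x ∧ ∃ w z, p.lhs.subtreeAt w = some (.leaf z) ∧
    (z ≠ none ∧ y = z ∨ z = none ∧ ¬ Constrained p w ∧ y = x)

theorem match_sink (t : GTree A) : G.toWTGc.Match (.leaf none) t := by
  induction t with
  | leaf z => exact z.elim
  | node s ts ih =>
    exact .leaf (sinkProd A G.n s) _ (G.sink_mem s) (.node _ _ _ ih) (by simp [sinkProd])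

/-- The least element `u` of the class of `w` is the position to which `constr_sink` applies; it
carries the proper label as soon as the class has a second element. -/
theorem exists_least {p : Production A (Option (Fin G.n))} (hp : p ∈ G.toWTGc.prods) {w x : Pos}
    (h : (w, x) ∈ p.constr) : ∃ u, (u, w) ∈ p.constr ∧
      ∀ v, (u, v) ∈ p.constr → v ≠ u → p.lhs.subtreeAt v = some (.leaf none) ∧
        p.lhs.subtreeAt u ≠ some (.leaf none) := by
  classical
  obtain ⟨u, hu, hle⟩ := Pos.exists_least ((p.constr.filter fun c => c.1 = w).image Prod.snd)
    ⟨x, Finset.mem_image.2 ⟨(w, x), by simp [h], rfl⟩⟩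
  have mem (v : Pos) : v ∈ (p.constr.filter fun c => c.1 = w).image Prod.snd ↔ (w, v) ∈ p.constr := by
    simp
  simp only [mem] at hu hle
  refine ⟨u, G.constr_symm p hp _ _ hu, fun v hv hvu => G.constr_sink p hp u v hv hvu fun y hy => ?_⟩
  exact hle y (G.constr_trans p hp _ _ _ hu hy)

/-- Only the least element of a class with several elements has a proper label, so `w` is that
element. -/
theorem subtreeAt_eq_sink {p : Production A (Option (Fin G.n))} (hp : p ∈ G.toWTGc.prods)
    {w x : Pos} {z : Option (Fin G.n)} (hw : p.lhs.subtreeAt w = some (.leaf z)) (hz : z ≠ none)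
    (h : (w, x) ∈ p.constr) (hx : x ≠ w) : p.lhs.subtreeAt x = some (.leaf none) := by
  obtain ⟨u, hu, hs⟩ := exists_least hp h
  by_cases huw : w = u
  · subst huw
    exact (hs x h hx).1
  · have := (hs w hu huw).1
    rw [hw] at this
    simp [hz] at this

/-- Put `t` at `w` and at all positions tied to `w`, and keep the subtrees of `s` elsewhere. The
tied positions are labelled `⊥` if `z` is proper, and there are none if `z = ⊥`. Every class of
constraints is changed as a whole or not at all, so the constraints still hold. -/
theorem exists_match_subtreeAt {p : Production A (Option (Fin G.n))} (hp : p ∈ G.toWTGc.prods)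
    {w : Pos} {z : Option (Fin G.n)} (hw : p.lhs.subtreeAt w = some (.leaf z))
    (hz : z ≠ none ∨ ¬ Constrained p w) {s t : GTree A} (hs : G.toWTGc.Match p.lhs s)
    (hc : ∀ c ∈ p.constr, s.Satisfies c) (ht : G.toWTGc.Match (.leaf z) t) :
    ∃ s' : GTree A, G.toWTGc.Match p.lhs s' ∧ (∀ c ∈ p.constr, s'.Satisfies c) ∧
      s'.subtreeAt w = some t := by
  classical
  -- `fill` evaluates `τ` only at leaves of the left-hand side, which are positions of `s`, so the
  -- default value of `getD` plays no role.
  set τ : Pos → GTree A := fun x =>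
    if x = w ∨ (w, x) ∈ p.constr then t else (s.subtreeAt x).getD t with hτ
  refine ⟨p.lhs.fill τ, WTGc.match_fill fun x y hx => ?_, fun c h => ?_, ?_⟩
  · by_cases hxw : x = w
    · subst hxw
      obtain rfl : z = y := by simpa [hw] using hx
      simpa [hτ] using ht
    by_cases hx' : (w, x) ∈ p.constr
    · have hz' : z ≠ none := hz.resolve_right fun h => h ⟨(w, x), hx', Ne.symm hxw, rfl⟩
      obtain rfl : none = y := by simpa [subtreeAt_eq_sink hp hw hz' hx' hxw] using hx
      exact match_sink _
    · obtain ⟨u, hu, hm, -⟩ := hs.subtreeAt hx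
      simpa [hτ, hxw, hx', hu] using hm
  · obtain ⟨a, b⟩ := c
    obtain ⟨⟨x, hx⟩, ⟨y, hy⟩⟩ := G.constr_pos p hp _ h
    refine ⟨τ a, subtreeAt_fill hx, ?_⟩
    have hab : τ a = τ b := by
      have h' := G.constr_symm p hp _ _ h
      have hiff : (a = w ∨ (w, a) ∈ p.constr) ↔ (b = w ∨ (w, b) ∈ p.constr) := by
        constructor
        · rintro (rfl | ha)
          · exact .inr h
          · exact .inr (G.constr_trans p hp _ _ _ ha h)
        · rintro (rfl | hb)
          · exact .inr h'
          · exact .inr (G.constr_trans p hp _ _ _ hb h')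
      obtain ⟨u, hu, hu'⟩ := hc _ h
      simp only at hu hu'
      simp only [hτ, hiff, hu, hu']
    rw [hab]
    exact subtreeAt_fill hy
  · rw [subtreeAt_fill hw]
    simp [hτ]

/-- Each edge plants the tree for its end strictly below the root of a tree for its start. For a
loop due to a free `⊥`, a tree for `x` itself is planted, since `⊥` accepts it. -/
theorem exists_high_of_walk
    (hG : ∀ p ∈ G.toWTGc.prods, ∃ s, G.toWTGc.Match p.lhs s ∧ ∀ c ∈ p.constr, s.Satisfies c)
    {k : ℕ} {x : Option (Fin G.n)} (hx : ∃ t, G.toWTGc.Match (.leaf x) t)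
    (h : Walk G.Edge k x) : ∃ t, G.toWTGc.Match (.leaf x) t ∧ k ≤ t.height := by
  induction k generalizing x with
  | zero =>
    obtain ⟨t, ht⟩ := hx
    exact ⟨t, ht, Nat.zero_le _⟩
  | succ k ih =>
    obtain ⟨y, ⟨p, hp, rfl, w, z, hw, hz⟩, h⟩ := h
    obtain ⟨s, hs, hc⟩ := hG p hp
    have hp' : w ≠ [] := by
      rintro rfl
      rw [subtreeAt_nil, Option.some.injEq] at hw
      exact p.lhs_not_state z hw
    have : ∃ t, G.toWTGc.Match (.leaf z) t ∧ k ≤ t.height := by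
      rcases hz with ⟨-, rfl⟩ | ⟨rfl, -, rfl⟩
      · obtain ⟨u, -, hm, -⟩ := hs.subtreeAt hw
        exact ih ⟨u, hm⟩ h
      · obtain ⟨t, -, ht⟩ := ih hx h
        exact ⟨t, match_sink t, ht⟩
    obtain ⟨t, ht, hk⟩ := this
    obtain ⟨s', hs', hc', hst⟩ := exists_match_subtreeAt hp hw
      (by rcases hz with hz | hz <;> [exact .inl hz.1; exact .inr hz.2.1]) hs hc ht
    refine ⟨s', .leaf p s' hp hs' hc', ?_⟩
    have := height_add_length_le hst
    have := List.length_pos_of_ne_nil hp'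
    omega

/-- Below the left-hand side of the production at the root, some leaf still has a subtree higher
than `k` times the maximal height. A proper leaf gives an edge and the induction goes on; a free `⊥`
gives a loop and ends it; a constrained `⊥` has the same subtree as the least position of its class,
whose proper leaf takes over. -/
theorem walk_of_high {k : ℕ} {x : Option (Fin G.n)} {t : GTree A} (h : G.toWTGc.Match (.leaf x) t)
    (ht : k * G.toWTGc.prods.sup Production.height < t.height) : Walk G.Edge k x := by
  induction k generalizing x t with
  | zero => trivial
  | succ k ih =>
    cases h with
    | leaf p _ hp h hc =>
      have hle : p.lhs.height ≤ G.toWTGc.prods.sup Production.height :=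
        Finset.le_sup (f := Production.height) hp
      rw [add_mul, one_mul] at ht
      obtain ⟨w, z, s, hw, hs, hm, hlt⟩ := h.exists_high_leaf
        (m := k * G.toWTGc.prods.sup Production.height) (by omega)
      by_cases hz : z = none
      · subst hz
        by_cases hf : Constrained p w
        · obtain ⟨⟨w', x⟩, hwx, hne, rfl⟩ := hf
          simp only at hne hw hs
          obtain ⟨u, hu, hsink⟩ := exists_least hp hwx
          have huw : w' ≠ u := by
            rintro rfl
            exact (hsink x hwx hne.symm).2 hw
          obtain ⟨y, hy⟩ := (G.constr_pos p hp _ hu).1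
          simp only at hy
          obtain ⟨v, hv, hv'⟩ := hc _ hu
          obtain ⟨v', hv'', hm', -⟩ := h.subtreeAt hy
          simp only at hv hv'
          obtain rfl : s = v := by simpa [hs] using hv'
          obtain rfl : s = v' := by simpa [hv] using hv''
          have hy' : y ≠ none := by
            rintro rfl
            exact (hsink w' hu huw).2 hy
          exact ⟨y, ⟨p, hp, rfl, u, y, hy, .inl ⟨hy', rfl⟩⟩, ih hm' hlt⟩
        · exact Walk.of_loop ⟨p, hp, rfl, w, none, hw, .inr ⟨rfl, hf, rfl⟩⟩ _
      · exact ⟨z, ⟨p, hp, rfl, w, z, hw, .inl ⟨hz, rfl⟩⟩, ih hm hlt⟩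

/-- Copies of trees that are derived to the state `y` are created by some production. -/
def Duplicated (G : WTGh A) (y : Option (Fin G.n)) : Prop :=
  ∃ p ∈ G.toWTGc.prods, ∃ w, p.lhs.subtreeAt w = some (.leaf y) ∧ y ≠ none ∧ Constrained p w

/-- Sink productions are exempt from trimness. They match as soon as any tree without indices
exists, which `t₀` provides; without symbols of rank 0 there would be none. -/
theorem IsTrim.exists_match (hG : G.IsTrim) (t₀ : GTree A) {p : Production A (Option (Fin G.n))}
    (hp : p ∈ G.toWTGc.prods) :
    ∃ s, G.toWTGc.Match p.lhs s ∧ ∀ c ∈ p.constr, s.Satisfies c := by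
  by_cases h : ∃ s, p = sinkProd A G.n s
  · obtain ⟨s, rfl⟩ := h
    exact ⟨.node s fun _ => t₀, .node _ _ _ fun _ => match_sink _, by simp [sinkProd]⟩
  · exact (hG ⟨p, hp⟩ (not_exists.1 h)).exists_match

/-- As `k` is arbitrary above `ht(G)`, the machine may run too many rounds instead of computing
`ht(G)`. -/
theorem largeDuplicationProperty_iff (hG : G.IsTrim) {k : ℕ} (hk : G.height < k) :
    G.LargeDuplicationProperty ↔ ∃ y, G.Duplicated y ∧ Walk G.Edge k y := by
  constructor
  · rintro ⟨p, hp, u, v, huv, q, hu, hq, hv, t, ht, hd⟩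
    refine ⟨q, ⟨p, hp, u, hu, hq, (u, v), huv, ?_, rfl⟩, ?_⟩
    · intro (h : u = v)
      rw [← h, hu] at hv
      simp [hq] at hv
    · have := walk_of_high (WTGc.derivations_nonempty_iff.1 hd) ht
      -- `this` is a walk of length |Q|. Edges never lead from a proper state to `⊥`, so the
      -- pigeonhole argument takes place among the |Q| proper states.
      refine this.of_card_le (s := Finset.univ.filter (· ≠ none)) ?_ ?_ (by simpa using hq) k
      · rintro x hx y ⟨p, -, rfl, w, z, -, ⟨hz, rfl⟩ | ⟨-, -, rfl⟩⟩
        · simpa using hz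
        · exact hx
      · simp [Finset.filter_ne', Finset.card_erase_of_mem]
  · rintro ⟨y, ⟨p, hp, w, hw, hy, ⟨w', v⟩, hwv, hne, rfl⟩, h⟩
    simp only at hne hw
    have hv := subtreeAt_eq_sink hp hw hy hwv hne.symm
    -- A production with a constraint is no sink production, so trimness applies to it and supplies
    -- the tree `t₀`.
    have hns : ∀ s, p ≠ sinkProd A G.n s := by
      rintro s rfl
      simp [sinkProd] at hwv
    obtain ⟨t₀, hm, -⟩ := (hG ⟨p, hp⟩ hns).exists_match
    obtain ⟨u, -, hu, -⟩ := hm.subtreeAt hw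
    obtain ⟨t, ht, hkt⟩ := exists_high_of_walk (fun p hp => hG.exists_match t₀ hp) ⟨u, hu⟩ h
    exact ⟨p, hp, w', v, hwv, y, hw, hy, hv, t, by omega, WTGc.derivations_nonempty_iff.2 ht⟩

end WTGh

/-! ### The edge list of the program represents the graph of states -/

namespace Cmd

open InputSymbol

variable {A : RankedAlphabet}

theorem mem_leaves {n : ℕ} {t : RTree A (Option (Fin n))} {w v : Pos} {z : Option (Fin n)} :
    (z, v) ∈ leaves t w ↔ ∃ x, v = w ++ x ∧ t.subtreeAt x = some (.leaf z) := by
  induction t generalizing w with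
  | leaf q =>
    rw [leaves, List.mem_singleton, Prod.mk.injEq]
    constructor
    · rintro ⟨rfl, rfl⟩
      exact ⟨[], by simp, RTree.subtreeAt_nil _⟩
    · rintro ⟨x, rfl, h⟩
      cases x with
      | nil => simpa [RTree.subtreeAt, eq_comm] using h
      | cons j x => simp [RTree.subtreeAt] at h
  | node s ts ih =>
    rw [leaves, List.mem_flatten]
    constructor
    · rintro ⟨l, hl, h⟩
      obtain ⟨i, rfl⟩ := List.mem_ofFn.1 hl
      obtain ⟨x, rfl, hx⟩ := (ih i).1 h
      exact ⟨i.val :: x, by simp, by rwa [RTree.subtreeAt_node]⟩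
    · rintro ⟨x, rfl, hx⟩
      cases x with
      | nil => simp [RTree.subtreeAt] at hx
      | cons j x =>
        obtain ⟨i, rfl, hi⟩ := RTree.exists_of_subtreeAt_node hx
        exact ⟨_, List.mem_ofFn.2 ⟨i, rfl⟩, (ih i).2 ⟨x, by simp, hi⟩⟩

theorem height_le_length_codeTree {n : ℕ} (t : RTree A (Option (Fin n))) :
    t.height ≤ (codeTree t).length := by
  induction t with
  | leaf q => exact Nat.zero_le _
  | node s ts ih =>
    rw [RTree.height]
    refine Finset.sup_le fun i _ => ?_
    have := length_codeTree_child s ts i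
    have := ih i
    omega

/-- A round demands that the end of an edge start another surviving edge, which lengthens the
required walk by one. -/
theorem mem_keepEdges_iterate {l : List (List (Tok A) × List (Tok A))} {k : ℕ}
    {p : List (Tok A) × List (Tok A)} :
    p ∈ keepEdges^[k] l ↔ p ∈ l ∧ Walk (fun a b => (a, b) ∈ l) k p.2 := by
  induction k generalizing p with
  | zero => simp [Walk]
  | succ k ih =>
    rw [Function.iterate_succ_apply', mem_keepEdges, ih]
    constructor
    · rintro ⟨⟨hp, -⟩, q, hq, h⟩
      rw [ih] at hq
      exact ⟨hp, q.2, by rw [← h]; exact hq.1, hq.2⟩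
    · rintro ⟨hp, h⟩
      obtain ⟨y, hy, hw⟩ := id h
      exact ⟨⟨hp, h.of_succ⟩, (p.2, y), ih.2 ⟨hy, hw⟩, rfl⟩

theorem mem_leafEdges {n : ℕ} {x y : Option (Fin n)} {b : Bool}
    {p : List (Tok A) × List (Tok A)} :
    p ∈ leafEdges x y b ↔ (y ≠ none ∧ p = (stateKey x, stateKey y)) ∨
      (y = none ∧ b = false ∧ p = (stateKey x, stateKey x)) ∨
      (y ≠ none ∧ b = true ∧ p = ([.src], stateKey y)) := by
  rcases y with _ | i <;> cases b <;> simp [leafEdges, or_comm]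

/-- Keeps the source apart from the states: it is never the end of an edge, so source edges do not
affect walks between states. -/
theorem stateKey_ne_src {n : ℕ} (x : Option (Fin n)) : (stateKey x : List (Tok A)) ≠ [.src] := by
  intro h
  have : (.src : Tok A) ∈ stateKey x := by simp [h]
  simp [stateKey, toks] at this

section

variable {G : WTGh A} {ps : List {p // p ∈ G.toWTGc.prods}}
  {es : {p // p ∈ G.toWTGc.prods} → List (Pos × Pos)}

/-- Only membership in the lists matters here, so the order of enumeration in the code becomes
irrelevant. -/
theorem mem_edges (hps : ∀ p, p ∈ ps) (hes : ∀ p e, e ∈ es p ↔ e ∈ p.1.constr)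
    {e : List (Tok A) × List (Tok A)} :
    e ∈ edges (fun p => p.1.lhs) (fun p => p.1.target) es ps ↔
      (∃ x y, G.Edge x y ∧ e = (stateKey x, stateKey y)) ∨
      ∃ y, G.Duplicated y ∧ e = ([.src], stateKey y) := by
  classical
  have hcon (p : {p // p ∈ G.toWTGc.prods}) (w : Pos) :
      (∃ c ∈ es p, c.1 ≠ c.2 ∧ c.1 = w) ↔ WTGh.Constrained p.1 w := by
    simp only [WTGh.Constrained, hes]
  simp only [edges, prodEdges, List.mem_flatMap, List.mem_reverse]
  constructor
  · rintro ⟨p, -, ⟨z, w⟩, hzw, he⟩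
    obtain ⟨w, rfl, hw⟩ := mem_leaves.1 hzw
    rw [mem_leafEdges] at he
    rcases he with ⟨hz, rfl⟩ | ⟨hz, hb, rfl⟩ | ⟨hz, hb, rfl⟩
    · exact .inl ⟨_, _, ⟨p.1, p.2, rfl, w, z, hw, .inl ⟨hz, rfl⟩⟩, rfl⟩
    · rw [decide_eq_false_iff_not, hcon] at hb
      exact .inl ⟨_, _, ⟨p.1, p.2, rfl, w, z, hw, .inr ⟨hz, by simpa using hb, rfl⟩⟩, rfl⟩
    · rw [decide_eq_true_eq, hcon] at hb
      exact .inr ⟨_, ⟨p.1, p.2, w, hw, hz, by simpa using hb⟩, rfl⟩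
  · rintro (⟨x, y, ⟨p, hp, rfl, w, z, hw, h⟩, rfl⟩ | ⟨y, ⟨p, hp, w, hw, hy, h⟩, rfl⟩)
    · refine ⟨⟨p, hp⟩, hps _, (z, w), mem_leaves.2 ⟨w, by simp, hw⟩, mem_leafEdges.2 ?_⟩
      rcases h with ⟨hz, rfl⟩ | ⟨hz, hc, rfl⟩
      · exact .inl ⟨hz, rfl⟩
      · exact .inr (.inl ⟨hz, by rw [decide_eq_false_iff_not, hcon]; exact hc, rfl⟩)
    · refine ⟨⟨p, hp⟩, hps _, (y, w), mem_leaves.2 ⟨w, by simp, hw⟩, mem_leafEdges.2 ?_⟩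
      exact .inr (.inr ⟨hy, by rw [decide_eq_true_eq, hcon]; exact h, rfl⟩)

theorem walk_edges_iff (hps : ∀ p, p ∈ ps) (hes : ∀ p e, e ∈ es p ↔ e ∈ p.1.constr) {k : ℕ}
    {x : Option (Fin G.n)} :
    Walk (fun a b : List (Tok A) => (a, b) ∈ edges (fun p => p.1.lhs) (fun p => p.1.target) es ps) k
      (stateKey x) ↔ Walk G.Edge k x := by
  induction k generalizing x with
  | zero => simp [Walk]
  | succ k ih =>
    constructor
    · rintro ⟨b, hb, hw⟩
      rcases (mem_edges hps hes).1 hb with ⟨x', y, h, e⟩ | ⟨y, -, e⟩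
      · obtain ⟨hx, rfl⟩ := Prod.mk.inj e
        obtain rfl := stateKey_injective hx
        exact ⟨y, h, ih.1 hw⟩
      · exact absurd (Prod.mk.inj e).1 (stateKey_ne_src x)
    · rintro ⟨y, h, hw⟩
      exact ⟨stateKey y, (mem_edges hps hes).2 (.inl ⟨x, y, h, rfl⟩), ih.2 hw⟩

theorem exists_src_iff (hps : ∀ p, p ∈ ps) (hes : ∀ p e, e ∈ es p ↔ e ∈ p.1.constr) {k : ℕ} :
    (∃ p ∈ keepEdges^[k] (edges (fun p => p.1.lhs) (fun p => p.1.target) es ps),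
      p.1 = ([.src] : List (Tok A))) ↔ ∃ y, G.Duplicated y ∧ Walk G.Edge k y := by
  simp only [mem_keepEdges_iterate]
  constructor
  · rintro ⟨p, ⟨hp, hw⟩, h⟩
    rcases (mem_edges hps hes).1 hp with ⟨x, y, -, rfl⟩ | ⟨y, hy, rfl⟩
    · exact absurd h (stateKey_ne_src x)
    · exact ⟨y, hy, (walk_edges_iff hps hes).1 hw⟩
  · rintro ⟨y, hy, hw⟩
    exact ⟨([.src], stateKey y), ⟨(mem_edges hps hes).2 (.inr ⟨y, hy, rfl⟩),
      (walk_edges_iff hps hes).2 hw⟩, rfl⟩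

end

end Cmd

/-! ### Finiteness of the alphabets, and the conclusion -/

instance InputSymbol.finite (A : RankedAlphabet) : Finite (InputSymbol A) :=
  letI := A.fin
  Finite.of_surjective (fun x : A.Sym ⊕ Bool ⊕ Fin 3 => match x with
    | .inl s => InputSymbol.sym s
    | .inr (.inl b) => .bit b
    | .inr (.inr 0) => .bot
    | .inr (.inr 1) => .item
    | .inr (.inr 2) => .close) fun a => by
      cases a with
      | sym s => exact ⟨.inl s, rfl⟩
      | bit b => exact ⟨.inr (.inl b), rfl⟩
      | bot => exact ⟨.inr (.inr 0), rfl⟩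
      | item => exact ⟨.inr (.inr 1), rfl⟩
      | close => exact ⟨.inr (.inr 2), rfl⟩

instance Tok.finite (A : RankedAlphabet) : Finite (Tok A) :=
  letI := A.fin
  Finite.of_surjective
    (fun x : InputSymbol A ⊕ (Σ s : A.Sym, Fin (A.rank s)) ⊕ Fin 3 => match x with
    | .inl a => Tok.inp a
    | .inr (.inl ⟨s, i⟩) => .dir s i
    | .inr (.inr 0) => .root
    | .inr (.inr 1) => .sep
    | .inr (.inr 2) => .src) fun a => by
      cases a with
      | inp a => exact ⟨.inl a, rfl⟩
      | dir s i => exact ⟨.inr (.inl ⟨s, i⟩), rfl⟩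
      | root => exact ⟨.inr (.inr 0), rfl⟩
      | sep => exact ⟨.inr (.inr 1), rfl⟩
      | src => exact ⟨.inr (.inr 2), rfl⟩

theorem WTGh.exists_eval_decideDuplication {A : RankedAlphabet} {G : WTGh A} (trim : G.IsTrim)
    {c : List (InputSymbol A)} (hG : G.IsCode c) :
    ∃ y : List (Tok A), (y ≠ [] ↔ G.LargeDuplicationProperty) ∧ y.length ≤ 1 ∧
      Cmd.eval c.length Cmd.decideDuplication (Function.update (fun _ => []) .W (Cmd.toks c).reverse)
        = Function.update (fun _ => []) .G y := by
  classical
  obtain ⟨ps, es, -, hps, hes, hc⟩ := hG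
  have hes' : ∀ p e, e ∈ es p ↔ e ∈ p.1.constr := fun p => (hes p).2
  set l : List (Option (Fin G.n)) := none :: (List.finRange G.n).map some with hl
  change c = InputSymbol.codeList (fun q => InputSymbol.codeNat (G.toWTGc.final q)) l ++
    Cmd.codeProds (fun p => p.1.lhs) (fun p => p.1.target) (fun p => G.toWTGc.wt p) es ps at hc
  have heval := Cmd.eval_decideDuplication (fun p : {p // p ∈ G.toWTGc.prods} => p.1.lhs)
    (fun p => p.1.target) (fun p => G.toWTGc.wt p) es G.toWTGc.final l (List.cons_ne_nil _ _) ps hc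
  have hlen := congrArg List.length hc
  rw [List.length_append] at hlen
  have hn : G.n + 1 ≤ c.length := by
    have := Cmd.length_le_codeList (A := A) (fun q => InputSymbol.codeNat (G.toWTGc.final q)) l
    simp only [hl, List.length_cons, List.length_map, List.length_finRange] at this
    rw [← hl] at this
    omega
  have hH : G.toWTGc.prods.sup Production.height ≤ c.length := by
    refine Finset.sup_le fun p hp => ?_
    have h1 := Cmd.length_mem_codeList (A := A) (fun p => Cmd.codeProd p.1.lhs p.1.target
      (G.toWTGc.wt p) (es p)) (hps ⟨p, hp⟩)
    have h2 := Cmd.height_le_length_codeTree p.lhs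
    simp only [Cmd.codeProd, List.length_append] at h1
    simp only [Cmd.codeProds, Cmd.codeProd] at hlen
    rw [Production.height]
    omega
  have hN : c.length * c.length ≤ Cmd.bound c.length :=
    (Nat.le_mul_of_pos_right _ (by omega)).trans (Nat.le_mul_of_pos_right _ (by omega))
  -- With `N` the input length, |Q| < `N` because every state including `⊥` has a listed final
  -- weight, and left-hand sides are no higher than their codes are long. So `ht(G) < N * N`, and
  -- the `bound N` rounds are enough.
  have hk : G.height < Cmd.bound c.length := by
    refine lt_of_lt_of_le ?_ hN
    rw [WTGh.height]
    calc _ ≤ G.n * c.length := Nat.mul_le_mul_left _ hH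
      _ < c.length * c.length := Nat.mul_lt_mul_of_pos_right (by omega) (by omega)
  refine ⟨_, ?_, ?_, heval⟩
  · rw [WTGh.largeDuplicationProperty_iff trim hk, ← Cmd.exists_src_iff hps hes']
    simp [Cmd.flag]
  · unfold Cmd.flag
    split_ifs <;> simp

theorem mainTheorem4 (A : RankedAlphabet) :
    PolyTimeDecidable (fun x : TrimInput A => x.code)
      (fun x : TrimInput A => x.G.LargeDuplicationProperty) := by
  exact polyTimeDecidable_of_cmd _ _ Cmd.decideDuplication .W .G Tok.inp .sep fun x =>
    x.G.exists_eval_decideDuplication x.trim x.isCode
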